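/- Let $\mathscr A$ be a non-empty set (the alphabet). For $F\subseteq\mathscr A^*$ let $\mathsf X=\mathsf X_F\subseteq\mathscr A^{\mathbb N}$ be the subshift of all sequences in which no word of $F$ occurs. Let $\mathcal L_{\mathsf X}$ be the set of all finite words occurring in elements of $\mathsf X$, including the empty word $\omega$, and assume that every letter $a\in\mathscr A$ belongs to $\mathcal L_{\mathsf X}$. For $\alpha,\beta\in\mathcal L_{\mathsf X}$ put $C(\alpha,\beta)=\{\beta x\in\mathsf X:\alpha x\in\mathsf X\}$, and let $\mathcal U$ be the Boolean algebra of subsets of $\mathsf X$ generated by all the sets $C(\alpha,\beta)$. Let $R$ be a field. The unital subshift algebra $\widetilde{\mathcal A}_R(\mathsf X)$ is the universal unital $R$-algebra with generators $\{p_A:A\in\mathcal U\}$ and $\{s_a,s_a^*:a\in\mathscr A\}$ subject to the relations (i) $p_{\mathsf X}=1$, $p_{A\cap B}=p_Ap_B$, $p_{A\cup B}=p_A+p_B-p_{A\cap B}$ and $p_\emptyset=0$ for all $A,B\in\mathcal U$; (ii) $s_as_a^*s_a=s_a$ and $s_a^*s_as_a^*=s_a^*$ for all $a\in\mathscr A$;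 (iii) $s_\beta s_\alpha^*s_\alpha s_\beta^*=p_{C(\alpha,\beta)}$ for all $\alpha,\beta\in\mathcal L_{\mathsf X}$, where $s_\omega=s_\omega^*=1$ and, for $\alpha=\alpha_1\cdots\alpha_n$, $s_\alpha=s_{\alpha_1}\cdots s_{\alpha_n}$ and $s_\alpha^*=s_{\alpha_n}^*\cdots s_{\alpha_1}^*$. Let $\mathcal Q_{\mathsf X}$ (the set of irrational paths) be the set of all singletons $\{p\}\in\mathcal U$ such that $p\neq\alpha\beta^\infty$ for all $\alpha,\beta\in\mathcal L_{\mathsf X}$ with $\beta\neq\omega$, where $\beta^\infty=\beta\beta\beta\cdots$. Let $\operatorname{Soc}(B)$ denote the (left) socle of a ring $B$, i.e. the sum of all minimal left ideals of $B$. **Theorem.** $$\operatorname{Soc}\bigl(\widetilde{\mathcal A}_R(\mathsf X)\bigr)=\sum_{A\in\mathcal Q_{\mathsf X}}\widetilde{\mathcal A}_R(\mathsf X)\,p_A .$$ -/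

import Mathlib

namespace UnitalSubshift

universe u v

section Symbolic

variable {𝒜 : Type u}

/-- The concatenation `w x` of a finite word `w` and an infinite sequence `x`. -/
def concat (w : List 𝒜) (x : ℕ → 𝒜) : ℕ → 𝒜 :=
  fun n => if h : n < w.length then w[n] else x (n - w.length)

/-- The infinite word `w w w …`, for a nonempty word `w`. -/
def infPow (w : List 𝒜) (hw : w ≠ []) : ℕ → 𝒜 :=
  fun n => w[n % w.length]'(Nat.mod_lt _ (List.length_pos_iff.mpr hw))

/-- The word of length `n` that occurs in the sequence `x` at position `i`. -/
def word (x : ℕ → 𝒜) (i n : ℕ) : List 𝒜 :=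
  List.ofFn (fun k : Fin n => x (i + k))

/-- The subshift `X_F`: the sequences in which no word of `F` occurs. -/
def avoiding (F : Set (List 𝒜)) : Set (ℕ → 𝒜) :=
  {x | ∀ i n : ℕ, word x i n ∉ F}

/-- A subshift over `𝒜` is a set of sequences of the form `X_F`. -/
def IsSubshift (X : Set (ℕ → 𝒜)) : Prop :=
  ∃ F : Set (List 𝒜), X = avoiding F

/-- The language of `X`: the finite initial words of the elements of `X`. -/
def language (X : Set (ℕ → 𝒜)) : Set (List 𝒜) :=
  {w | ∃ x ∈ X, ∃ n : ℕ, word x 0 n = w}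

/-- `C(α, β) = {β x ∈ X : α x ∈ X}`, as a subset of `X`. -/
def cylinder (X : Set (ℕ → 𝒜)) (α β : List 𝒜) : Set X :=
  {y | ∃ x : ℕ → 𝒜, (y : ℕ → 𝒜) = concat β x ∧ concat α x ∈ X}

/-- The Boolean algebra `𝒰` of subsets of `X` generated by the sets `C(α, β)` with
`α`, `β` in the language of `X`. -/
def boolAlg (X : Set (ℕ → 𝒜)) : BooleanSubalgebra (Set X) :=
  BooleanSubalgebra.closure {A | ∃ α ∈ language X, ∃ β ∈ language X, A = cylinder X α β}

/-- The irrational paths of `X`: the singletons `{p}` in `𝒰` such that `p` is not of the form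
`α β^∞` with `α`, `β` in the language of `X` (and `β` nonempty, so that `β^∞` makes sense). -/
def irrationalPaths (X : Set (ℕ → 𝒜)) : Set (boolAlg X) :=
  {A | ∃ p : X, (A : Set X) = {p} ∧
    ∀ α ∈ language X, ∀ β ∈ language X, ∀ hβ : β ≠ [],
      (p : ℕ → 𝒜) ≠ concat α (infPow β hβ)}

end Symbolic

section Algebra

/-- The generators of the unital subshift algebra: `p_A` for `A ∈ 𝒰`, and `s_a`, `s_a^*` for each
letter `a`. -/
inductive Gen {𝒜 : Type u} (X : Set (ℕ → 𝒜)) : Type u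
  | p (A : boolAlg X) : Gen X
  | s (a : 𝒜) : Gen X
  | sStar (a : 𝒜) : Gen X

variable (R : Type v) [CommRing R] {𝒜 : Type u} (X : Set (ℕ → 𝒜))

/-- The free generator `p_A`. -/
def freeP (A : boolAlg X) : FreeAlgebra R (Gen X) := FreeAlgebra.ι R (Gen.p A)

/-- The free generator `s_a`. -/
def freeS (a : 𝒜) : FreeAlgebra R (Gen X) := FreeAlgebra.ι R (Gen.s a)

/-- The free generator `s_a^*`. -/
def freeSStar (a : 𝒜) : FreeAlgebra R (Gen X) := FreeAlgebra.ι R (Gen.sStar a)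

/-- `s_α = s_{α₁} ⋯ s_{αₙ}`, which is `1` for the empty word. -/
def freeSWord (α : List 𝒜) : FreeAlgebra R (Gen X) := (α.map (freeS R X)).prod

/-- `s_α^* = s_{αₙ}^* ⋯ s_{α₁}^*`, which is `1` for the empty word. -/
def freeSStarWord (α : List 𝒜) : FreeAlgebra R (Gen X) := (α.reverse.map (freeSStar R X)).prod

/-- The defining relations of the unital subshift algebra. -/
inductive Rel : FreeAlgebra R (Gen X) → FreeAlgebra R (Gen X) → Prop
  | p_top : Rel (freeP R X ⊤) 1
  | p_inf (A B : boolAlg X) : Rel (freeP R X (A ⊓ B)) (freeP R X A * freeP R X B)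
  | p_sup (A B : boolAlg X) :
      Rel (freeP R X (A ⊔ B)) (freeP R X A + freeP R X B - freeP R X (A ⊓ B))
  | p_bot : Rel (freeP R X ⊥) 0
  | s_sStar_s (a : 𝒜) : Rel (freeS R X a * freeSStar R X a * freeS R X a) (freeS R X a)
  | sStar_s_sStar (a : 𝒜) :
      Rel (freeSStar R X a * freeS R X a * freeSStar R X a) (freeSStar R X a)
  | cyl (α β : List 𝒜) (hα : α ∈ language X) (hβ : β ∈ language X) :
      Rel (freeSWord R X β * freeSStarWord R X α * freeSWord R X α * freeSStarWord R X β)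
        (freeP R X ⟨cylinder X α β, BooleanSubalgebra.subset_closure ⟨α, hα, β, hβ, rfl⟩⟩)

/-- The unital subshift algebra of `X` over `R`: the universal unital `R`-algebra on the
generators `Gen X` subject to the relations `Rel R X`. -/
abbrev SubshiftAlgebra : Type (max u v) := RingQuot (Rel R X)

/-- The element `p_A` of the unital subshift algebra. -/
noncomputable def projection (A : boolAlg X) : SubshiftAlgebra R X :=
  RingQuot.mkAlgHom R (Rel R X) (freeP R X A)

end Algebra

/-- The (left) socle of a ring: the sum of all its minimal left ideals.
(`Ideal B` is the lattice of left ideals of `B`; its atoms are the minimal nonzero ones.) -/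
def leftSocle (B : Type v) [Ring B] : Ideal B :=
  sSup {I : Ideal B | IsAtom I}

end UnitalSubshift

/-!
The algebra acts on the free `R[T;T⁻¹]`-module with basis `δ_x`, `x ∈ X`: `s_a` sends `δ_x` to
`T δ_{ax}`, or to zero if `ax ∉ X`, and `p_A` restricts to `A`. Every element is a linear
combination of monomials `s_α s_β^* p_D`, and near a point `q` such a monomial is determined by the
image of `q` and the power of `T`. Hence an element vanishes as soon as it kills every `δ_q`.

If `{p}` is an irrational path, the coefficients of `w δ_p` are monomials `c Tⁿ`, because there is
at most one lag `n` from `p` to any point. Over a field, a nonzero `w p_{p}` can thus be carried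
back to `p_{p}`, so the left ideal generated by `p_{p}` is minimal.

Conversely, a minimal left ideal contains some `y` with `y δ_p = f δ_q` and `f ≠ 0`. An element of
the ideal is determined by its value on `δ_p`, so `p_W y = y` for every `W ∈ 𝒰` containing `q`.
Therefore `y^*` kills all points other than `q`, whence `{q} ∈ 𝒰`; minimality excludes that `q` has
a nonzero lag to itself. Now `y = p_{q} y` lies in the two-sided ideal generated by the irrational
projections. This ideal is already generated as a left ideal, because the generators of the algebra
normalize the diagonal.
-/

namespace UnitalSubshift

variable {𝒜 : Type*}

section Words

variable {w : List 𝒜} {x y z : ℕ → 𝒜} {m n : ℤ}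

@[simp] theorem concat_nil (x : ℕ → 𝒜) : concat [] x = x := by
  funext n
  simp [concat]

theorem concat_append (v w : List 𝒜) (x : ℕ → 𝒜) :
    concat (v ++ w) x = concat v (concat w x) := by
  funext n
  simp only [concat, List.length_append, List.getElem_append, Nat.sub_sub]
  split_ifs <;> first | rfl | omega

theorem concat_cons (a : 𝒜) (w : List 𝒜) (x : ℕ → 𝒜) :
    concat (a :: w) x = concat [a] (concat w x) :=
  concat_append [a] w x

theorem concat_add_length (w : List 𝒜) (x : ℕ → 𝒜) (n : ℕ) :
    concat w x (n + w.length) = x n := by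
  simp [concat]

theorem concat_injective (w : List 𝒜) : Function.Injective (concat w) := fun x y h =>
  funext fun n => by rw [← concat_add_length w x, h, concat_add_length]

theorem word_concat (w : List 𝒜) (x : ℕ → 𝒜) : word (concat w x) 0 w.length = w :=
  List.ext_getElem (by simp [word]) fun n _ _ => by simp [word, concat]

theorem exists_eq_concat_word (x : ℕ → 𝒜) (n : ℕ) : ∃ y, x = concat (word x 0 n) y := by
  refine ⟨fun k => x (k + n), funext fun k => ?_⟩
  by_cases h : k < n
  · simp [concat, word, h]
  · simp [concat, word, h, Nat.sub_add_cancel (not_lt.mp h)]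

theorem exists_append_of_concat_eq {v : List 𝒜} (h : concat v x = concat w y)
    (hwv : w.length ≤ v.length) : ∃ u, v = w ++ u ∧ y = concat u x := by
  have hw : v.take w.length = w := List.ext_getElem (by simpa using hwv) fun n h₁ h₂ => by
    have := congrFun h n
    simp only [concat, h₂, h₂.trans_le hwv, dif_pos] at this
    simpa using this
  have hv : v = w ++ v.drop w.length := by
    conv_lhs => rw [← List.take_append_drop w.length v, hw]
  refine ⟨v.drop w.length, hv, concat_injective w ?_⟩
  rw [← h, ← concat_append, ← hv]

theorem concat_infPow (hw : w ≠ []) : concat w (infPow w hw) = infPow w hw := by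
  funext n
  by_cases h : n < w.length
  · simp [concat, infPow, h, Nat.mod_eq_of_lt h]
  · simp [concat, infPow, h, Nat.mod_eq_sub_mod (not_lt.mp h)]

theorem concat_eq_self_iff (hw : w ≠ []) : concat w x = x ↔ x = infPow w hw := by
  refine ⟨fun h => funext fun n => ?_, fun h => h ▸ concat_infPow hw⟩
  have hpos : 0 < w.length := List.length_pos_iff.mpr hw
  induction n using Nat.strong_induction_on with
  | _ n ih =>
    rw [← h, ← concat_infPow hw]
    by_cases hn : n < w.length
    · simp [concat, hn]
    · simp only [concat, hn, dif_neg, not_false_eq_true]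
      exact ih _ (by omega)

/-- The lags between two sequences: the integers `n` for which `y` arises from `x` by exchanging a
finite prefix for one that is longer by `n`. The sequences are tail equivalent iff there is a lag;
in groupoid terms, `(y, n, x)` is then an arrow of the Deaconu–Renault groupoid of the shift. -/
def lags (x y : ℕ → 𝒜) : Set ℤ :=
  {n | ∃ α β z, x = concat β z ∧ y = concat α z ∧ (α.length : ℤ) - β.length = n}

theorem neg_mem_lags (h : n ∈ lags x y) : -n ∈ lags y x := by
  obtain ⟨α, β, z, hx, hy, rfl⟩ := h
  exact ⟨β, α, z, hy, hx, by ring⟩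

theorem add_mem_lags (hm : m ∈ lags x y) (hn : n ∈ lags y z) : m + n ∈ lags x z := by
  obtain ⟨α, β, u, rfl, hy, rfl⟩ := hm
  obtain ⟨γ, δ, v, hy', rfl, rfl⟩ := hn
  have h : concat α u = concat δ v := hy.symm.trans hy'
  rcases le_total δ.length α.length with hle | hle
  · obtain ⟨ε, rfl, rfl⟩ := exists_append_of_concat_eq h hle
    refine ⟨γ ++ ε, β, u, rfl, (concat_append ..).symm, ?_⟩
    simp only [List.length_append]
    omega
  · obtain ⟨ε, rfl, rfl⟩ := exists_append_of_concat_eq h.symm hle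
    refine ⟨γ, β ++ ε, v, (concat_append ..).symm, rfl, ?_⟩
    simp only [List.length_append]
    omega

/-- A sequence is aperiodic if its only lag to itself is zero, i.e. if it has trivial isotropy. -/
def Aperiodic (x : ℕ → 𝒜) : Prop := lags x x ⊆ {0}

theorem Aperiodic.of_mem_lags (hx : Aperiodic x) (hn : n ∈ lags x y) : Aperiodic y := fun m hm => by
  have := hx (add_mem_lags (add_mem_lags hn hm) (neg_mem_lags hn))
  simpa using this

theorem Aperiodic.lags_subsingleton (hx : Aperiodic x) (y : ℕ → 𝒜) :
    (lags x y).Subsingleton := fun _ hm _ hn => by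
  have := hx (add_mem_lags hm (neg_mem_lags hn))
  simpa [add_neg_eq_zero] using this

theorem not_aperiodic_iff :
    ¬ Aperiodic x ↔ ∃ α β, ∃ hβ : β ≠ [], x = concat α (infPow β hβ) := by
  constructor
  · intro h
    obtain ⟨n, hn, hpos⟩ : ∃ n ∈ lags x x, 0 < n := by
      obtain ⟨n, hn, h0⟩ := Set.not_subset.mp h
      rcases lt_or_gt_of_ne h0 with hneg | hpos
      · exact ⟨-n, neg_mem_lags hn, neg_pos.mpr hneg⟩
      · exact ⟨n, hn, hpos⟩
    obtain ⟨α, β, z, hβ, hα, rfl⟩ := hn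
    obtain ⟨γ, rfl, hz⟩ := exists_append_of_concat_eq (hα.symm.trans hβ) (by omega)
    have hγ : γ ≠ [] := by
      rintro rfl
      simp at hpos
    exact ⟨β, γ, hγ, by rw [← (concat_eq_self_iff hγ).mp hz.symm, ← hβ]⟩
  · rintro ⟨α, β, hβ, rfl⟩ h
    have hmem : (β.length : ℤ) ∈ lags (concat α (infPow β hβ)) (concat α (infPow β hβ)) :=
      ⟨α ++ β, α, infPow β hβ, rfl, by rw [concat_append, concat_infPow], by simp⟩
    simpa [hβ] using h hmem

end Words

section Subshift

variable {X : Set (ℕ → 𝒜)}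

theorem IsSubshift.mem_of_concat_mem (hX : IsSubshift X) {w : List 𝒜} {x : ℕ → 𝒜}
    (h : concat w x ∈ X) : x ∈ X := by
  obtain ⟨F, rfl⟩ := hX
  intro i n
  have hword : word x i n = word (concat w x) (i + w.length) n := by
    simp only [word, add_right_comm i, concat_add_length]
  exact hword ▸ h _ _

theorem mem_language_iff {w : List 𝒜} : w ∈ language X ↔ ∃ x, concat w x ∈ X := by
  constructor
  · rintro ⟨x, hx, n, rfl⟩
    obtain ⟨y, hy⟩ := exists_eq_concat_word x n
    exact ⟨y, hy ▸ hx⟩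
  · rintro ⟨x, hx⟩
    exact ⟨_, hx, w.length, word_concat w x⟩

theorem mem_language_of_append_left {v w : List 𝒜} (h : v ++ w ∈ language X) :
    v ∈ language X := by
  obtain ⟨x, hx⟩ := mem_language_iff.mp h
  exact mem_language_iff.mpr ⟨_, concat_append v w x ▸ hx⟩

theorem IsSubshift.mem_language_of_append_right (hX : IsSubshift X) {v w : List 𝒜}
    (h : v ++ w ∈ language X) : w ∈ language X := by
  obtain ⟨x, hx⟩ := mem_language_iff.mp h
  rw [concat_append] at hx
  exact mem_language_iff.mpr ⟨x, hX.mem_of_concat_mem hx⟩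

theorem nil_mem_language {w : List 𝒜} (h : w ∈ language X) : [] ∈ language X :=
  mem_language_of_append_left (v := []) h

theorem mem_irrationalPaths_iff (hX : IsSubshift X) {A : boolAlg X} :
    A ∈ irrationalPaths X ↔ ∃ p : X, (A : Set X) = {p} ∧ Aperiodic (p : ℕ → 𝒜) := by
  refine exists_congr fun p => and_congr_right fun _ => ?_
  rw [← not_iff_not, not_aperiodic_iff]
  push Not
  constructor
  · rintro ⟨α, -, β, -, hβ, h⟩
    exact ⟨α, β, hβ, h⟩
  · rintro ⟨α, β, hβ, h⟩
    have hαβ : concat (α ++ β) (infPow β hβ) ∈ X := by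
      rw [concat_append, concat_infPow, ← h]
      exact p.2
    have hmem := mem_language_iff.mpr ⟨_, hαβ⟩
    exact ⟨α, mem_language_of_append_left hmem, β, hX.mem_language_of_append_right hmem, hβ, h⟩

theorem cylinder_eq_empty {α β : List 𝒜} (h : ¬ (α ∈ language X ∧ β ∈ language X)) :
    cylinder X α β = ∅ :=
  Set.eq_empty_of_forall_notMem fun y ⟨x, hy, hαx⟩ =>
    h ⟨mem_language_iff.mpr ⟨x, hαx⟩, mem_language_iff.mpr ⟨x, hy ▸ y.2⟩⟩

theorem cylinder_mem_boolAlg (α β : List 𝒜) : cylinder X α β ∈ boolAlg X := by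
  by_cases h : α ∈ language X ∧ β ∈ language X
  · exact BooleanSubalgebra.subset_closure ⟨α, h.1, β, h.2, rfl⟩
  · exact cylinder_eq_empty h ▸ BooleanSubalgebra.bot_mem

variable (X) in
/-- The set `C(α, β)` as an element of the Boolean algebra `𝒰`. Words outside the language are
admitted; they give the empty set. -/
def cyl (α β : List 𝒜) : boolAlg X := ⟨cylinder X α β, cylinder_mem_boolAlg α β⟩

theorem cyl_eq_bot {α β : List 𝒜} (h : ¬ (α ∈ language X ∧ β ∈ language X)) : cyl X α β = ⊥ :=
  Subtype.ext (cylinder_eq_empty h)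

theorem boolAlg_induction {motive : boolAlg X → Prop} (cyl : ∀ α β, motive (cyl X α β))
    (bot : motive ⊥) (sup : ∀ A B, motive A → motive B → motive (A ⊔ B))
    (compl : ∀ A, motive A → motive Aᶜ) (A : boolAlg X) : motive A := by
  obtain ⟨A, hA⟩ := A
  induction hA using BooleanSubalgebra.closure_bot_sup_induction with
  | mem A hA =>
    obtain ⟨α, -, β, -, rfl⟩ := hA
    exact cyl α β
  | bot => exact bot
  | sup A hA B hB ihA ihB => exact sup ⟨A, hA⟩ ⟨B, hB⟩ ihA ihB
  | compl A hA ihA => exact compl ⟨A, hA⟩ ihA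

theorem mem_cyl_nil_left (hX : IsSubshift X) {β : List 𝒜} {x : X} :
    x ∈ (cyl X [] β : Set X) ↔ ∃ z, (x : ℕ → 𝒜) = concat β z := by
  refine exists_congr fun z => and_iff_left_of_imp fun h => ?_
  rw [concat_nil]
  exact hX.mem_of_concat_mem (h ▸ x.2)

theorem disjoint_boolAlg_iff {A B : boolAlg X} :
    Disjoint A B ↔ Disjoint (A : Set X) (B : Set X) := by
  rw [disjoint_iff, disjoint_iff, Subtype.ext_iff]
  rfl

theorem exists_mem_forall_notMem (hX : IsSubshift X) {q : X} {F : Finset X} (hq : q ∉ F) :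
    ∃ W : boolAlg X, q ∈ (W : Set X) ∧ ∀ x ∈ F, x ∉ (W : Set X) := by
  classical
  induction F using Finset.induction_on with
  | empty => exact ⟨⊤, trivial, by simp⟩
  | insert x F _ ih =>
    rw [Finset.mem_insert, not_or] at hq
    obtain ⟨W, hqW, hW⟩ := ih hq.2
    obtain ⟨n, hn⟩ := Function.ne_iff.mp fun h => hq.1 (Subtype.ext h)
    refine ⟨W ⊓ cyl X [] (word q 0 (n + 1)),
      ⟨hqW, (mem_cyl_nil_left hX).mpr (exists_eq_concat_word _ _)⟩, fun y hy hyW => ?_⟩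
    rcases Finset.mem_insert.mp hy with rfl | hy
    · obtain ⟨z, hz⟩ := (mem_cyl_nil_left hX).mp hyW.2
      exact hn (by simp [hz, concat, word, -List.ofFn_succ])
    · exact hW y hy hyW.1

end Subshift

section Algebra

variable (R : Type*) [CommRing R] {X : Set (ℕ → 𝒜)}

variable (X) in
/-- The element `s_a` of the unital subshift algebra. The element `s_a^*` is its adjoint for the
involution defined below. -/
noncomputable def sLetter (a : 𝒜) : SubshiftAlgebra R X :=
  RingQuot.mkAlgHom R (Rel R X) (freeS R X a)

variable (X) in
/-- The element `s_α = s_{α₁} ⋯ s_{αₙ}` of the unital subshift algebra. -/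
noncomputable def sWord (α : List 𝒜) : SubshiftAlgebra R X := (α.map (sLetter R X)).prod

theorem projection_top : projection R X ⊤ = 1 := by
  simpa [projection] using RingQuot.mkAlgHom_rel R (Rel.p_top (R := R) (X := X))

theorem projection_bot : projection R X ⊥ = 0 := by
  simpa [projection] using RingQuot.mkAlgHom_rel R (Rel.p_bot (R := R) (X := X))

theorem projection_inf (A B : boolAlg X) :
    projection R X (A ⊓ B) = projection R X A * projection R X B := by
  simpa [projection] using RingQuot.mkAlgHom_rel R (Rel.p_inf (R := R) A B)

theorem projection_sup (A B : boolAlg X) :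
    projection R X (A ⊔ B) = projection R X A + projection R X B - projection R X (A ⊓ B) := by
  simpa [projection] using RingQuot.mkAlgHom_rel R (Rel.p_sup (R := R) A B)

theorem projection_mul_comm (A B : boolAlg X) :
    projection R X A * projection R X B = projection R X B * projection R X A := by
  rw [← projection_inf, ← projection_inf, inf_comm]

theorem projection_mul_of_ge {A B : boolAlg X} (h : B ≤ A) :
    projection R X A * projection R X B = projection R X B := by
  rw [← projection_inf, inf_eq_right.mpr h]

theorem projection_mul_of_disjoint {A B : boolAlg X} (h : Disjoint A B) :
    projection R X A * projection R X B = 0 := by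
  rw [← projection_inf, h.eq_bot, projection_bot]

theorem projection_compl (A : boolAlg X) : projection R X Aᶜ = 1 - projection R X A := by
  have h := projection_sup R A Aᶜ
  rw [sup_compl_eq_top, inf_compl_eq_bot, projection_top, projection_bot, sub_zero] at h
  rw [h, add_sub_cancel_left]

/-- The homomorphism `p_A ↦ p_A`, `s_a ↦ s_a^*`, `s_a^* ↦ s_a` from the free algebra to the opposite
of the unital subshift algebra. -/
noncomputable def freeToOpposite : FreeAlgebra R (Gen X) →ₐ[R] (SubshiftAlgebra R X)ᵐᵒᵖ :=
  FreeAlgebra.lift R fun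
    | .p A => .op (RingQuot.mkAlgHom R (Rel R X) (freeP R X A))
    | .s a => .op (RingQuot.mkAlgHom R (Rel R X) (freeSStar R X a))
    | .sStar a => .op (RingQuot.mkAlgHom R (Rel R X) (freeS R X a))

theorem freeToOpposite_freeP (A : boolAlg X) :
    freeToOpposite R (freeP R X A) = .op (RingQuot.mkAlgHom R (Rel R X) (freeP R X A)) :=
  FreeAlgebra.lift_ι_apply ..

theorem freeToOpposite_freeS (a : 𝒜) : freeToOpposite R (freeS R X a) =
    .op (RingQuot.mkAlgHom R (Rel R X) (freeSStar R X a)) :=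
  FreeAlgebra.lift_ι_apply ..

theorem freeToOpposite_freeSStar (a : 𝒜) :
    freeToOpposite R (freeSStar R X a) = .op (RingQuot.mkAlgHom R (Rel R X) (freeS R X a)) :=
  FreeAlgebra.lift_ι_apply ..

theorem freeToOpposite_freeSWord (α : List 𝒜) : freeToOpposite R (freeSWord R X α) =
    .op (RingQuot.mkAlgHom R (Rel R X) (freeSStarWord R X α)) := by
  simp [freeSWord, freeSStarWord, map_list_prod, MulOpposite.op_list_prod, Function.comp_def,
    freeToOpposite_freeS]

theorem freeToOpposite_freeSStarWord (α : List 𝒜) : freeToOpposite R (freeSStarWord R X α) =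
    .op (RingQuot.mkAlgHom R (Rel R X) (freeSWord R X α)) := by
  simp [freeSWord, freeSStarWord, map_list_prod, MulOpposite.op_list_prod, Function.comp_def,
    freeToOpposite_freeSStar]

theorem freeToOpposite_rel ⦃y z : FreeAlgebra R (Gen X)⦄ (h : Rel R X y z) :
    freeToOpposite R y = freeToOpposite R z := by
  have hrel := congrArg MulOpposite.op (RingQuot.mkAlgHom_rel R h)
  cases h with
  | p_top => simpa [freeToOpposite_freeP] using hrel
  | p_inf A B =>
    simpa only [map_mul, freeToOpposite_freeP, inf_comm, MulOpposite.op_mul] using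
      congrArg MulOpposite.op (RingQuot.mkAlgHom_rel R (Rel.p_inf (R := R) B A))
  | p_sup A B => simpa [freeToOpposite_freeP] using hrel
  | p_bot => simpa [freeToOpposite_freeP] using hrel
  | s_sStar_s a =>
    simpa only [map_mul, freeToOpposite_freeS, freeToOpposite_freeSStar, MulOpposite.op_mul,
      mul_assoc] using congrArg MulOpposite.op (RingQuot.mkAlgHom_rel R (Rel.sStar_s_sStar a))
  | sStar_s_sStar a =>
    simpa only [map_mul, freeToOpposite_freeS, freeToOpposite_freeSStar, MulOpposite.op_mul,
      mul_assoc] using congrArg MulOpposite.op (RingQuot.mkAlgHom_rel R (Rel.s_sStar_s a))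
  | cyl α β hα hβ =>
    simpa only [map_mul, freeToOpposite_freeSWord, freeToOpposite_freeSStarWord,
      freeToOpposite_freeP, MulOpposite.op_mul, mul_assoc] using hrel

noncomputable instance : Star (SubshiftAlgebra R X) where
  star y := (RingQuot.liftAlgHom R ⟨freeToOpposite R, freeToOpposite_rel R⟩ y).unop

theorem star_mkAlgHom (y : FreeAlgebra R (Gen X)) :
    star (RingQuot.mkAlgHom R (Rel R X) y) = (freeToOpposite R y).unop := by
  simp [star]

variable {R} in
theorem subshiftAlgebra_induction {motive : SubshiftAlgebra R X → Prop}
    (scalar : ∀ r, motive (algebraMap R _ r)) (proj : ∀ A, motive (projection R X A))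
    (letter : ∀ a, motive (sLetter R X a))
    (star_letter : ∀ a, motive (star (sLetter R X a)))
    (mul : ∀ y z, motive y → motive z → motive (y * z))
    (add : ∀ y z, motive y → motive z → motive (y + z)) (y : SubshiftAlgebra R X) : motive y := by
  obtain ⟨y, rfl⟩ := RingQuot.mkAlgHom_surjective R (Rel R X) y
  induction y using FreeAlgebra.induction with
  | grade0 r => simpa using scalar r
  | grade1 g =>
    cases g with
    | p A => exact proj A
    | s a => exact letter a
    | sStar a =>
      have h := star_letter a
      rwa [sLetter, star_mkAlgHom, freeToOpposite_freeS] at h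
  | mul y z hy hz => simpa using mul _ _ hy hz
  | add y z hy hz => simpa using add _ _ hy hz

theorem star_projection (A : boolAlg X) : star (projection R X A) = projection R X A := by
  rw [projection, star_mkAlgHom, freeToOpposite_freeP]
  rfl

noncomputable instance : StarRing (SubshiftAlgebra R X) where
  star_add y z := by simp [star]
  star_mul y z := by simp [star]
  star_involutive y := by
    have hmul (y z : SubshiftAlgebra R X) : star (y * z) = star z * star y := by simp [star]
    have hadd (y z : SubshiftAlgebra R X) : star (y + z) = star y + star z := by simp [star]
    have hletter (a : 𝒜) : star (star (sLetter R X a)) = sLetter R X a := by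
      rw [sLetter, star_mkAlgHom, freeToOpposite_freeS, MulOpposite.unop_op, star_mkAlgHom,
        freeToOpposite_freeSStar, MulOpposite.unop_op]
    induction y using subshiftAlgebra_induction with
    | scalar r => simp [star]
    | proj A => rw [star_projection, star_projection]
    | letter a => exact hletter a
    | star_letter a => rw [hletter]
    | mul y z hy hz => rw [hmul, hmul, hy, hz]
    | add y z hy hz => rw [hadd, hadd, hy, hz]

theorem sLetter_mul_star_mul (a : 𝒜) :
    sLetter R X a * star (sLetter R X a) * sLetter R X a = sLetter R X a := by
  simpa only [sLetter, star_mkAlgHom, freeToOpposite_freeS, MulOpposite.unop_op, map_mul] using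
    RingQuot.mkAlgHom_rel R (Rel.s_sStar_s (R := R) (X := X) a)

@[simp] theorem sWord_nil : sWord R X [] = 1 := rfl

theorem sWord_cons (a : 𝒜) (α : List 𝒜) :
    sWord R X (a :: α) = sLetter R X a * sWord R X α := by
  simp [sWord]

theorem sWord_append (α β : List 𝒜) : sWord R X (α ++ β) = sWord R X α * sWord R X β := by
  simp [sWord]

theorem mkAlgHom_freeSWord (α : List 𝒜) :
    RingQuot.mkAlgHom R (Rel R X) (freeSWord R X α) = sWord R X α := by
  simp only [freeSWord, sWord, map_list_prod, List.map_map]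
  rfl

theorem mkAlgHom_freeSStarWord (α : List 𝒜) :
    RingQuot.mkAlgHom R (Rel R X) (freeSStarWord R X α) = star (sWord R X α) := by
  rw [← mkAlgHom_freeSWord, star_mkAlgHom, freeToOpposite_freeSWord, MulOpposite.unop_op]

theorem projection_cyl_of_mem_language {α β : List 𝒜} (hα : α ∈ language X)
    (hβ : β ∈ language X) :
    sWord R X β * star (sWord R X α) * sWord R X α * star (sWord R X β) =
      projection R X (cyl X α β) := by
  simpa only [map_mul, mkAlgHom_freeSWord, mkAlgHom_freeSStarWord, projection, cyl] using
    RingQuot.mkAlgHom_rel R (Rel.cyl (R := R) α β hα hβ)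

theorem star_sWord_mul_sWord_of_mem_language {α : List 𝒜} (hα : α ∈ language X) :
    star (sWord R X α) * sWord R X α = projection R X (cyl X α []) := by
  simpa using projection_cyl_of_mem_language R hα (nil_mem_language hα)

theorem sWord_mul_star_sWord_of_mem_language {α : List 𝒜} (hα : α ∈ language X) :
    sWord R X α * star (sWord R X α) = projection R X (cyl X [] α) := by
  simpa using projection_cyl_of_mem_language R (nil_mem_language hα) hα

theorem sWord_singleton (a : 𝒜) : sWord R X [a] = sLetter R X a := by
  simp [sWord]

theorem sWord_mul_star_mul_of_mem_language (hX : IsSubshift X) {α : List 𝒜} (hα : α ∈ language X) :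
    sWord R X α * star (sWord R X α) * sWord R X α = sWord R X α := by
  induction α with
  | nil => simp
  | cons a α ih =>
    have hα' : α ∈ language X := hX.mem_language_of_append_right (v := [a]) hα
    have ha : [a] ∈ language X := mem_language_of_append_left (w := α) hα
    have hcomm := projection_mul_comm R (cyl X [a] []) (cyl X [] α)
    rw [← star_sWord_mul_sWord_of_mem_language R ha, ← sWord_mul_star_sWord_of_mem_language R hα',
      sWord_singleton] at hcomm
    calc sWord R X (a :: α) * star (sWord R X (a :: α)) * sWord R X (a :: α)
        = sLetter R X a * (sWord R X α * star (sWord R X α) *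
            (star (sLetter R X a) * sLetter R X a)) * sWord R X α := by
          simp only [sWord_cons, star_mul, mul_assoc]
      _ = sLetter R X a * star (sLetter R X a) * sLetter R X a *
            (sWord R X α * star (sWord R X α) * sWord R X α) := by
          rw [← hcomm]
          simp only [mul_assoc]
      _ = sWord R X (a :: α) := by
          rw [sLetter_mul_star_mul, ih hα', sWord_cons]

theorem sWord_eq_zero (hX : IsSubshift X) (hl : ∀ a : 𝒜, [a] ∈ language X) {α : List 𝒜}
    (hα : α ∉ language X) : sWord R X α = 0 := by
  induction α with
  | nil =>
    have htop : (⊤ : boolAlg X) = ⊥ := Subtype.ext <| Set.eq_empty_of_forall_notMem fun x _ =>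
      hα (mem_language_iff.mpr ⟨x, (concat_nil (x : ℕ → 𝒜)).symm ▸ x.2⟩)
    rw [sWord_nil, ← projection_top, htop, projection_bot]
  | cons a α ih =>
    rw [sWord_cons]
    by_cases hα' : α ∈ language X
    · have hdisj : Disjoint (cyl X [a] []) (cyl X [] α) :=
        disjoint_boolAlg_iff.mpr <| Set.disjoint_left.mpr fun x ⟨y, hy, hay⟩ ⟨z, hz, _⟩ => by
          rw [concat_nil] at hy
          rw [← hy, hz, ← concat_cons] at hay
          exact hα (mem_language_iff.mpr ⟨z, hay⟩)
      have hzero := projection_mul_of_disjoint R hdisj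
      rw [← star_sWord_mul_sWord_of_mem_language R (hl a),
        ← sWord_mul_star_sWord_of_mem_language R hα', sWord_singleton] at hzero
      calc sLetter R X a * sWord R X α
          = sLetter R X a * (star (sLetter R X a) * sLetter R X a *
              (sWord R X α * star (sWord R X α))) * sWord R X α := by
            conv_lhs => rw [← sLetter_mul_star_mul,
              ← sWord_mul_star_mul_of_mem_language R hX hα']
            simp only [mul_assoc]
        _ = 0 := by rw [hzero, mul_zero, zero_mul]
    · rw [ih hα', mul_zero]

theorem projection_cyl (hX : IsSubshift X) (hl : ∀ a : 𝒜, [a] ∈ language X) (α β : List 𝒜) :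
    projection R X (cyl X α β) =
      sWord R X β * star (sWord R X α) * sWord R X α * star (sWord R X β) := by
  by_cases h : α ∈ language X ∧ β ∈ language X
  · exact (projection_cyl_of_mem_language R h.1 h.2).symm
  · rw [cyl_eq_bot h, projection_bot]
    rcases not_and_or.mp h with h | h <;> simp [sWord_eq_zero R hX hl h]

theorem sWord_mul_star_mul (hX : IsSubshift X) (hl : ∀ a : 𝒜, [a] ∈ language X) (α : List 𝒜) :
    sWord R X α * star (sWord R X α) * sWord R X α = sWord R X α := by
  by_cases hα : α ∈ language X
  · exact sWord_mul_star_mul_of_mem_language R hX hα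
  · simp [sWord_eq_zero R hX hl hα]

theorem star_sWord_mul_sWord (hX : IsSubshift X) (hl : ∀ a : 𝒜, [a] ∈ language X) (α : List 𝒜) :
    star (sWord R X α) * sWord R X α = projection R X (cyl X α []) := by
  simp [projection_cyl R hX hl]

theorem sWord_mul_star_sWord (hX : IsSubshift X) (hl : ∀ a : 𝒜, [a] ∈ language X) (α : List 𝒜) :
    sWord R X α * star (sWord R X α) = projection R X (cyl X [] α) := by
  simp [projection_cyl R hX hl]

theorem star_sLetter_mul_of_ne (hl : ∀ a : 𝒜, [a] ∈ language X) {a b : 𝒜} (hab : a ≠ b) :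
    star (sLetter R X a) * sLetter R X b = 0 := by
  have hdisj : Disjoint (cyl X [] [a]) (cyl X [] [b]) :=
    disjoint_boolAlg_iff.mpr <| Set.disjoint_left.mpr fun x ⟨y, hy, _⟩ ⟨z, hz, _⟩ =>
      hab (by simpa [concat] using congrFun (hy.symm.trans hz) 0)
  have hzero := projection_mul_of_disjoint R hdisj
  rw [← sWord_mul_star_sWord_of_mem_language R (hl a),
    ← sWord_mul_star_sWord_of_mem_language R (hl b), sWord_singleton, sWord_singleton] at hzero
  calc star (sLetter R X a) * sLetter R X b
      = star (sLetter R X a) * (sLetter R X a * star (sLetter R X a) *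
          (sLetter R X b * star (sLetter R X b))) * sLetter R X b := by
        conv_lhs => rw [← sLetter_mul_star_mul R a, ← sLetter_mul_star_mul R b]
        simp only [star_mul, star_star, mul_assoc]
    _ = 0 := by rw [hzero, mul_zero, zero_mul]

end Algebra

section Normalizer

variable {R : Type*} [CommRing R] {X : Set (ℕ → 𝒜)} {u : SubshiftAlgebra R X}

/-- The partial isometries that normalize the diagonal subalgebra spanned by the projections `p_A`.
They move irrational paths to irrational paths. -/
structure IsNormalizer (u : SubshiftAlgebra R X) : Prop where
  mul_star_mul : u * star u * u = u
  exists_conj (A : boolAlg X) : ∃ B : boolAlg X, u * projection R X A * star u = projection R X B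
  exists_star_conj (A : boolAlg X) :
    ∃ B : boolAlg X, star u * projection R X A * u = projection R X B

theorem star_mul_mul_star {B : Type*} [Semigroup B] [StarMul B] {b : B} (hb : b * star b * b = b) :
    star b * b * star b = star b := by
  simpa [mul_assoc] using congrArg star hb

theorem isNormalizer_star (hu : IsNormalizer u) : IsNormalizer (star u) where
  mul_star_mul := by rw [star_star, star_mul_mul_star hu.mul_star_mul]
  exists_conj := by simpa using hu.exists_star_conj
  exists_star_conj := by simpa using hu.exists_conj

theorem mul_projection_inf_mul_star {E : boolAlg X} (hu : u * star u * u = u)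
    (hE : star u * u = projection R X E) (A B : boolAlg X) :
    u * projection R X (A ⊓ B) * star u =
      u * projection R X A * star u * (u * projection R X B * star u) :=
  calc u * projection R X (A ⊓ B) * star u
      = u * star u * u * projection R X (A ⊓ B) * star u := by rw [hu]
    _ = u * (projection R X E * projection R X A) * projection R X B * star u := by
        rw [← hE, projection_inf]
        simp only [mul_assoc]
    _ = u * projection R X A * star u * (u * projection R X B * star u) := by
        rw [projection_mul_comm, ← hE]
        simp only [mul_assoc]

theorem exists_conj_of_cyl {E F : boolAlg X} (hu : u * star u * u = u)
    (hE : star u * u = projection R X E) (hF : u * star u = projection R X F)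
    (hcyl : ∀ α β, ∃ B : boolAlg X,
      u * projection R X (cyl X α β) * star u = projection R X B) (A : boolAlg X) :
    ∃ B : boolAlg X, u * projection R X A * star u = projection R X B := by
  induction A using boolAlg_induction with
  | cyl α β => exact hcyl α β
  | bot => exact ⟨⊥, by rw [projection_bot, mul_zero, zero_mul]⟩
  | sup A B ihA ihB =>
    obtain ⟨C, hC⟩ := ihA
    obtain ⟨D, hD⟩ := ihB
    refine ⟨C ⊔ D, ?_⟩
    rw [projection_sup, projection_sup, projection_inf R C, ← hC, ← hD,
      ← mul_projection_inf_mul_star hu hE, mul_sub, mul_add, sub_mul, add_mul]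
  | compl A ihA =>
    obtain ⟨C, hC⟩ := ihA
    have hFC := mul_projection_inf_mul_star hu hE ⊤ A
    rw [top_inf_eq, hC, projection_top, mul_one, hF] at hFC
    refine ⟨F ⊓ Cᶜ, ?_⟩
    rw [projection_inf, projection_compl, projection_compl, mul_sub, sub_mul, mul_one, mul_sub,
      mul_one, hC, hF, ← hFC]

theorem IsNormalizer.of_cyl {E F : boolAlg X} (hu : u * star u * u = u)
    (hE : star u * u = projection R X E) (hF : u * star u = projection R X F)
    (hcyl : ∀ α β, ∃ B : boolAlg X,
      u * projection R X (cyl X α β) * star u = projection R X B)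
    (hcyl_star : ∀ α β, ∃ B : boolAlg X,
      star u * projection R X (cyl X α β) * u = projection R X B) :
    IsNormalizer u where
  mul_star_mul := hu
  exists_conj := exists_conj_of_cyl hu hE hF hcyl
  exists_star_conj := by
    simpa using exists_conj_of_cyl (u := star u) (by simpa using star_mul_mul_star hu)
      (by rw [star_star, hF]) (by rw [star_star, hE]) (by simpa using hcyl_star)

theorem IsNormalizer.exists_projection_mul_eq (hu : IsNormalizer u) (A : boolAlg X) :
    ∃ B : boolAlg X, star u * projection R X A * u = projection R X B ∧
      projection R X A * u = u * projection R X B := by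
  obtain ⟨B, hB⟩ := hu.exists_star_conj A
  obtain ⟨F, hF⟩ := hu.exists_conj ⊤
  rw [projection_top, mul_one] at hF
  refine ⟨B, hB, ?_⟩
  calc projection R X A * u = projection R X A * (u * star u) * u := by
        rw [mul_assoc, hu.mul_star_mul]
    _ = u * (star u * projection R X A * u) := by
        rw [hF, projection_mul_comm, ← hF]
        simp only [mul_assoc]
    _ = u * projection R X B := by rw [hB]

theorem isNormalizer_projection (A : boolAlg X) : IsNormalizer (projection R X A) where
  mul_star_mul := by simp only [star_projection, ← projection_inf, inf_idem]
  exists_conj B := ⟨A ⊓ B ⊓ A, by simp only [star_projection, projection_inf]⟩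
  exists_star_conj B := ⟨A ⊓ B ⊓ A, by simp only [star_projection, projection_inf]⟩

theorem exists_star_sLetter_conj_cyl (hX : IsSubshift X) (hl : ∀ a : 𝒜, [a] ∈ language X)
    (a : 𝒜) (α β : List 𝒜) : ∃ B : boolAlg X,
      star (sLetter R X a) * projection R X (cyl X α β) * sLetter R X a =
        projection R X B := by
  rw [projection_cyl R hX hl]
  cases β with
  | nil =>
    refine ⟨cyl X (α ++ [a]) [], ?_⟩
    simp [projection_cyl R hX hl, sWord_append, sWord_singleton, mul_assoc]
  | cons b β =>
    by_cases hab : a = b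
    · subst hab
      refine ⟨cyl X [a] [] ⊓ cyl X α β ⊓ cyl X [a] [], ?_⟩
      simp only [projection_cyl R hX hl, projection_inf, sWord_cons, sWord_nil, star_mul, star_one,
        mul_assoc, mul_one, one_mul]
    · refine ⟨⊥, ?_⟩
      simp [projection_bot, sWord_cons, ← mul_assoc, star_sLetter_mul_of_ne R hl hab]

theorem isNormalizer_sLetter (hX : IsSubshift X) (hl : ∀ a : 𝒜, [a] ∈ language X) (a : 𝒜) :
    IsNormalizer (sLetter R X a) :=
  .of_cyl (sLetter_mul_star_mul R a)
    (by simpa [sWord_singleton] using star_sWord_mul_sWord R hX hl [a])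
    (by simpa [sWord_singleton] using sWord_mul_star_sWord R hX hl [a])
    (fun α β => ⟨cyl X α (a :: β), by
      simp only [projection_cyl R hX hl, sWord_cons, star_mul, mul_assoc]⟩)
    (exists_star_sLetter_conj_cyl hX hl a)

end Normalizer

section Monomial

variable (R : Type*) [CommRing R] {X : Set (ℕ → 𝒜)}

theorem sWord_mul_star_sWord_mul_projection_cyl (hX : IsSubshift X)
    (hl : ∀ a : 𝒜, [a] ∈ language X) (α β : List 𝒜) :
    sWord R X α * star (sWord R X β) * projection R X (cyl X α β) =
      sWord R X α * star (sWord R X β) :=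
  calc sWord R X α * star (sWord R X β) * projection R X (cyl X α β)
      = sWord R X α * (star (sWord R X β) * sWord R X β * (star (sWord R X α) * sWord R X α)) *
          star (sWord R X β) := by
        rw [projection_cyl R hX hl]
        simp only [mul_assoc]
    _ = sWord R X α * star (sWord R X α) * sWord R X α *
          (star (sWord R X β) * sWord R X β * star (sWord R X β)) := by
        rw [star_sWord_mul_sWord R hX hl, star_sWord_mul_sWord R hX hl, projection_mul_comm,
          ← star_sWord_mul_sWord R hX hl, ← star_sWord_mul_sWord R hX hl]
        simp only [mul_assoc]
    _ = sWord R X α * star (sWord R X β) := by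
        rw [sWord_mul_star_mul R hX hl, star_mul_mul_star (sWord_mul_star_mul R hX hl β)]

variable (X) in
/-- The elements `s_α s_β^* p_D` with `D ⊆ C(α, β)`. The condition makes `x ↦ α z`, for `x = β z`, a
bijection from `D` onto its image in `X`. -/
def monomials : Set (SubshiftAlgebra R X) :=
  {m | ∃ (α β : List 𝒜) (D : boolAlg X), D ≤ cyl X α β ∧
    m = sWord R X α * star (sWord R X β) * projection R X D}

theorem mul_projection_mem_span_monomials (hX : IsSubshift X) (hl : ∀ a : 𝒜, [a] ∈ language X)
    (α β : List 𝒜) (D : boolAlg X) :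
    sWord R X α * star (sWord R X β) * projection R X D ∈
      Submodule.span R (monomials R X) := by
  rw [← sWord_mul_star_sWord_mul_projection_cyl R hX hl, mul_assoc, ← projection_inf]
  exact Submodule.subset_span ⟨α, β, _, inf_le_left, rfl⟩

theorem mul_sLetter_mem_span_monomials (hX : IsSubshift X) (hl : ∀ a : 𝒜, [a] ∈ language X)
    (α β : List 𝒜) (D : boolAlg X) (a : 𝒜) :
    sWord R X α * star (sWord R X β) * projection R X D * sLetter R X a ∈
      Submodule.span R (monomials R X) := by
  obtain ⟨B, -, hB⟩ := (isNormalizer_sLetter (R := R) hX hl a).exists_projection_mul_eq D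
  rw [mul_assoc, hB, ← mul_assoc]
  cases β with
  | nil =>
    simpa [sWord_append, sWord_singleton] using
      mul_projection_mem_span_monomials R hX hl (α ++ [a]) [] B
  | cons b β =>
    by_cases hab : b = a
    · subst hab
      have h := mul_projection_mem_span_monomials R hX hl α β (cyl X [b] [] ⊓ B)
      rw [projection_inf, ← star_sWord_mul_sWord R hX hl, sWord_singleton] at h
      simpa only [sWord_cons, star_mul, mul_assoc] using h
    · have hzero : sWord R X α * star (sWord R X (b :: β)) * sLetter R X a = 0 := by
        rw [sWord_cons, star_mul, mul_assoc, mul_assoc, star_sLetter_mul_of_ne R hl hab,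
          mul_zero, mul_zero]
      rw [hzero, zero_mul]
      exact zero_mem _

theorem mul_star_sLetter_mem_span_monomials (hX : IsSubshift X)
    (hl : ∀ a : 𝒜, [a] ∈ language X) (α β : List 𝒜) (D : boolAlg X) (a : 𝒜) :
    sWord R X α * star (sWord R X β) * projection R X D * star (sLetter R X a) ∈
      Submodule.span R (monomials R X) := by
  obtain ⟨B, -, hB⟩ :=
    (isNormalizer_star (isNormalizer_sLetter (R := R) hX hl a)).exists_projection_mul_eq D
  rw [mul_assoc, hB]
  simpa only [sWord_cons, star_mul, mul_assoc] using
    mul_projection_mem_span_monomials R hX hl α (a :: β) B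

theorem mul_mem_span_of_forall_mul_mem {A : Type*} [Semiring A] [Algebra R A] {s : Set A} {g z : A}
    (hg : ∀ m ∈ s, m * g ∈ Submodule.span R s) (hz : z ∈ Submodule.span R s) :
    z * g ∈ Submodule.span R s :=
  have hle : Submodule.span R s ≤ (Submodule.span R s).comap (LinearMap.mulRight R g) :=
    Submodule.span_le.mpr hg
  hle hz

theorem span_monomials (hX : IsSubshift X) (hl : ∀ a : 𝒜, [a] ∈ language X) :
    Submodule.span R (monomials R X) = ⊤ := by
  suffices h : ∀ y z : SubshiftAlgebra R X, z ∈ Submodule.span R (monomials R X) →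
      z * y ∈ Submodule.span R (monomials R X) by
    refine eq_top_iff.mpr fun y _ => one_mul y ▸ h y 1 ?_
    simpa [projection_top] using mul_projection_mem_span_monomials R hX hl [] [] ⊤
  intro y
  induction y using subshiftAlgebra_induction with
  | scalar r =>
    intro z hz
    rw [← Algebra.commutes, ← Algebra.smul_def]
    exact Submodule.smul_mem _ _ hz
  | proj A =>
    refine fun z => mul_mem_span_of_forall_mul_mem R ?_
    rintro _ ⟨α, β, D, -, rfl⟩
    rw [mul_assoc, ← projection_inf]
    exact mul_projection_mem_span_monomials R hX hl _ _ _
  | letter a =>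
    refine fun z => mul_mem_span_of_forall_mul_mem R ?_
    rintro _ ⟨α, β, D, -, rfl⟩
    exact mul_sLetter_mem_span_monomials R hX hl α β D a
  | star_letter a =>
    refine fun z => mul_mem_span_of_forall_mul_mem R ?_
    rintro _ ⟨α, β, D, -, rfl⟩
    exact mul_star_sLetter_mem_span_monomials R hX hl α β D a
  | mul y y' hy hy' => exact fun z hz => mul_assoc z y y' ▸ hy' _ (hy _ hz)
  | add y y' hy hy' => exact fun z hz => mul_add z y y' ▸ add_mem (hy _ hz) (hy' _ hz)

variable {R} in
theorem monomials_induction (hX : IsSubshift X) (hl : ∀ a : 𝒜, [a] ∈ language X)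
    {motive : SubshiftAlgebra R X → Prop}
    (mem : ∀ α β D, D ≤ cyl X α β →
      motive (sWord R X α * star (sWord R X β) * projection R X D))
    (zero : motive 0) (add : ∀ y z, motive y → motive z → motive (y + z))
    (smul : ∀ (r : R) y, motive y → motive (r • y)) (y : SubshiftAlgebra R X) : motive y := by
  have hy : y ∈ Submodule.span R (monomials R X) := span_monomials R hX hl ▸ Submodule.mem_top
  induction hy using Submodule.span_induction with
  | mem y hy =>
    obtain ⟨α, β, D, hD, rfl⟩ := hy
    exact mem α β D hD
  | zero => exact zero
  | add y z _ _ hy hz => exact add y z hy hz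
  | smul r y _ hy => exact smul r y hy

end Monomial

section Translation

open LaurentPolynomial

variable (R : Type*) [CommRing R] {ι : Type*}

/-- The partial permutation operator of `f`, weighted by `Tⁿ`: it sends the basis vector at `x` to
`Tⁿ` times the one at `f x`, and to zero if `f x` is undefined. -/
noncomputable def translation (f : ι ≃. ι) (n : ℤ) : Module.End R[T;T⁻¹] (ι →₀ R[T;T⁻¹]) :=
  Finsupp.linearCombination R[T;T⁻¹] fun x => (f x).elim 0 fun y => Finsupp.single y (T n)

variable {R}

theorem translation_single {f : ι ≃. ι} {x y : ι} (h : y ∈ f x) (n : ℤ) (c : R[T;T⁻¹]) :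
    translation R f n (.single x c) = .single y (c * T n) := by
  simp [translation, Option.mem_def.mp h]

theorem translation_single_eq_zero {f : ι ≃. ι} {x : ι} (h : f x = none) (n : ℤ) (c : R[T;T⁻¹]) :
    translation R f n (.single x c) = 0 := by
  simp [translation, h]

theorem translation_refl : translation R (.refl ι) 0 = 1 := by
  refine Finsupp.lhom_ext fun x c => ?_
  rw [translation_single (PEquiv.refl_apply x), T_zero, mul_one, Module.End.one_apply]

theorem translation_mul (f g : ι ≃. ι) (m n : ℤ) :
    translation R g m * translation R f n = translation R (f.trans g) (n + m) := by
  refine Finsupp.lhom_ext fun x c => ?_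
  rw [Module.End.mul_apply]
  cases hf : f x with
  | none =>
    have hfg : f.trans g x = none := by simp [PEquiv.trans, hf]
    rw [translation_single_eq_zero hf, map_zero, translation_single_eq_zero hfg]
  | some y =>
    have hfg : f.trans g x = g y := by simp [PEquiv.trans, hf]
    rw [translation_single hf]
    cases hg : g y with
    | none => rw [translation_single_eq_zero hg, translation_single_eq_zero (hfg.trans hg)]
    | some z => rw [translation_single hg, translation_single (hfg.trans hg), mul_assoc, T_add]

open scoped Classical in
theorem translation_ofSet_apply (A : Set ι) (f : ι →₀ R[T;T⁻¹]) :
    translation R (PEquiv.ofSet A) 0 f = f.filter (· ∈ A) := by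
  induction f using Finsupp.induction_linear with
  | zero => rw [map_zero, Finsupp.filter_zero]
  | add f g hf hg => rw [map_add, Finsupp.filter_add, hf, hg]
  | single x c =>
    by_cases hx : x ∈ A
    · rw [translation_single (PEquiv.mem_ofSet_self_iff.mpr hx), T_zero, mul_one,
        Finsupp.filter_single_of_pos _ hx]
    · rw [translation_single_eq_zero (by simp [PEquiv.ofSet, hx]),
        Finsupp.filter_single_of_neg _ hx]

theorem trans_symm_trans (f : ι ≃. ι) : (f.trans f.symm).trans f = f := by
  refine PEquiv.ext fun x => Option.ext fun y => ?_
  simp only [PEquiv.trans_assoc, PEquiv.trans_eq_some, PEquiv.eq_some_iff]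
  constructor
  · rintro ⟨z, hz, w, hw, hy⟩
    rwa [f.inj hz hw]
  · exact fun h => ⟨y, h, x, h, h⟩

theorem symm_trans_trans_symm (f : ι ≃. ι) : (f.symm.trans f).trans f.symm = f.symm := by
  simpa only [PEquiv.symm_symm] using trans_symm_trans f.symm

end Translation

section Representation

open LaurentPolynomial

variable (R : Type*) [CommRing R] {X : Set (ℕ → 𝒜)}

open Classical in
variable (X) in
/-- The partial bijection `x ↦ w x` of `X`. -/
noncomputable def prepend (w : List 𝒜) : X ≃. X where
  toFun x := if h : concat w x ∈ X then some ⟨concat w x, h⟩ else none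
  invFun y := if h : ∃ x : X, (y : ℕ → 𝒜) = concat w x then some h.choose else none
  inv x y := by
    constructor
    · intro h
      obtain ⟨hy, hx⟩ := Option.dite_none_right_eq_some.mp h
      obtain rfl := Option.some.inj hx
      exact Option.dite_none_right_eq_some.mpr ⟨hy.choose_spec ▸ y.2, by
        simp only [← hy.choose_spec, Subtype.coe_eta]⟩
    · intro h
      obtain ⟨hx, hy⟩ := Option.dite_none_right_eq_some.mp h
      obtain rfl := Option.some.inj hy
      have hy : ∃ z : X, concat w (x : ℕ → 𝒜) = concat w z := ⟨x, rfl⟩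
      exact Option.dite_none_right_eq_some.mpr ⟨hy, congrArg some <|
        Subtype.ext (concat_injective w hy.choose_spec).symm⟩

theorem mem_prepend {w : List 𝒜} {x y : X} :
    y ∈ prepend X w x ↔ (y : ℕ → 𝒜) = concat w x := by
  constructor
  · intro h
    obtain ⟨hx, hy⟩ := Option.dite_none_right_eq_some.mp h
    rw [← Option.some.inj hy]
  · intro h
    exact Option.dite_none_right_eq_some.mpr ⟨h ▸ y.2, congrArg some (Subtype.ext h.symm)⟩

theorem prepend_nil : prepend X [] = .refl X := by
  refine PEquiv.ext fun x => Option.ext fun y => ?_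
  rw [← Option.mem_def, mem_prepend]
  simp [Subtype.ext_iff, eq_comm]

theorem prepend_append (hX : IsSubshift X) (v w : List 𝒜) :
    prepend X (v ++ w) = (prepend X w).trans (prepend X v) := by
  refine PEquiv.ext fun x => Option.ext fun y => ?_
  rw [← Option.mem_def, ← Option.mem_def, PEquiv.mem_trans, mem_prepend, concat_append]
  simp only [mem_prepend]
  constructor
  · exact fun h => ⟨⟨_, hX.mem_of_concat_mem (h ▸ y.2)⟩, rfl, h⟩
  · rintro ⟨z, hz, hy⟩
    rw [hy, hz]

open Classical in
theorem prepend_symm_trans_eq_ofSet (hX : IsSubshift X) (α β : List 𝒜) :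
    (((prepend X β).symm.trans (prepend X α)).trans (prepend X α).symm).trans (prepend X β) =
      PEquiv.ofSet (cylinder X α β) := by
  have h := PEquiv.self_trans_symm ((prepend X β).symm.trans (prepend X α))
  rw [PEquiv.symm_trans_rev, PEquiv.symm_symm, ← PEquiv.trans_assoc] at h
  rw [h]
  congr 1
  ext x
  simp only [Option.isSome_iff_exists, ← Option.mem_def, Set.mem_ofPred_eq, PEquiv.mem_trans,
    PEquiv.mem_iff_mem, mem_prepend]
  constructor
  · rintro ⟨y, z, hx, hy⟩
    exact ⟨z, hx, hy ▸ y.2⟩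
  · rintro ⟨z, hx, hz⟩
    exact ⟨⟨_, hz⟩, ⟨z, hX.mem_of_concat_mem hz⟩, hx, rfl⟩

open Classical in
variable (X) in
/-- The representation of the free algebra underlying `pointRep`. -/
noncomputable def freePointRep :
    FreeAlgebra R (Gen X) →ₐ[R] Module.End R[T;T⁻¹] (X →₀ R[T;T⁻¹]) :=
  FreeAlgebra.lift R fun
    | .p A => translation R (PEquiv.ofSet (A : Set X)) 0
    | .s a => translation R (prepend X [a]) 1
    | .sStar a => translation R (prepend X [a]).symm (-1)

open Classical in
theorem freePointRep_freeP (A : boolAlg X) :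
    freePointRep R X (freeP R X A) = translation R (PEquiv.ofSet (A : Set X)) 0 :=
  FreeAlgebra.lift_ι_apply ..

theorem freePointRep_freeS (a : 𝒜) :
    freePointRep R X (freeS R X a) = translation R (prepend X [a]) 1 :=
  FreeAlgebra.lift_ι_apply ..

theorem freePointRep_freeSStar (a : 𝒜) :
    freePointRep R X (freeSStar R X a) = translation R (prepend X [a]).symm (-1) :=
  FreeAlgebra.lift_ι_apply ..

theorem freePointRep_freeSWord (hX : IsSubshift X) (α : List 𝒜) :
    freePointRep R X (freeSWord R X α) = translation R (prepend X α) α.length := by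
  induction α with
  | nil => simp [freeSWord, prepend_nil, translation_refl]
  | cons a α ih =>
    rw [freeSWord, List.map_cons, List.prod_cons, ← freeSWord, map_mul, ih, freePointRep_freeS,
      translation_mul, ← prepend_append hX]
    rfl

theorem freePointRep_freeSStarWord (hX : IsSubshift X) (α : List 𝒜) :
    freePointRep R X (freeSStarWord R X α) =
      translation R (prepend X α).symm (-α.length) := by
  induction α with
  | nil => simp [freeSStarWord, prepend_nil, translation_refl]
  | cons a α ih =>
    rw [freeSStarWord, List.reverse_cons, List.map_append, List.prod_append, ← freeSStarWord,
      List.map_singleton, List.prod_singleton, map_mul, ih, freePointRep_freeSStar,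
      translation_mul, ← PEquiv.symm_trans_rev, ← prepend_append hX]
    simp [add_comm]

open Classical in
theorem freePointRep_rel (hX : IsSubshift X) ⦃y z : FreeAlgebra R (Gen X)⦄ (h : Rel R X y z) :
    freePointRep R X y = freePointRep R X z := by
  cases h with
  | p_top =>
    rw [freePointRep_freeP, map_one]
    refine LinearMap.ext fun f => ?_
    rw [translation_ofSet_apply, Module.End.one_apply]
    exact Finsupp.filter_eq_self_iff _ _ |>.mpr fun _ _ => trivial
  | p_inf A B =>
    refine LinearMap.ext fun f => Finsupp.ext fun x => ?_
    simp only [map_mul, freePointRep_freeP, Module.End.mul_apply, translation_ofSet_apply,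
      Finsupp.filter_apply, BooleanSubalgebra.val_inf, Set.inf_eq_inter, Set.mem_inter_iff,
      ite_and]
  | p_sup A B =>
    refine LinearMap.ext fun f => Finsupp.ext fun x => ?_
    simp only [map_sub, map_add, freePointRep_freeP, LinearMap.sub_apply, LinearMap.add_apply,
      Finsupp.sub_apply, Finsupp.add_apply, translation_ofSet_apply, Finsupp.filter_apply,
      BooleanSubalgebra.val_sup, BooleanSubalgebra.val_inf, Set.sup_eq_union, Set.inf_eq_inter,
      Set.mem_union, Set.mem_inter_iff]
    by_cases hA : x ∈ (A : Set X) <;> by_cases hB : x ∈ (B : Set X) <;>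
      simp only [hA, hB, if_true, if_false, or_self, or_true, or_false, and_self, and_true,
        and_false, add_sub_cancel_right, add_zero, zero_add, sub_zero]
  | p_bot =>
    rw [freePointRep_freeP, map_zero]
    refine LinearMap.ext fun f => ?_
    rw [translation_ofSet_apply]
    exact Finsupp.filter_eq_zero_iff _ _ |>.mpr fun _ h => h.elim
  | s_sStar_s a =>
    simp only [map_mul, freePointRep_freeS, freePointRep_freeSStar, translation_mul,
      ← PEquiv.trans_assoc, trans_symm_trans]
    norm_num
  | sStar_s_sStar a =>
    simp only [map_mul, freePointRep_freeS, freePointRep_freeSStar, translation_mul,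
      ← PEquiv.trans_assoc]
    rw [symm_trans_trans_symm]
    norm_num
  | cyl α β hα hβ =>
    simp only [map_mul, freePointRep_freeSWord R hX, freePointRep_freeSStarWord R hX,
      freePointRep_freeP, translation_mul, ← PEquiv.trans_assoc, prepend_symm_trans_eq_ofSet hX]
    congr 1
    ring

/-- The representation of the unital subshift algebra on the free module over the points of `X`, in
which `s_a` sends a point `x` to `T • a x` if `a x ∈ X` and to zero otherwise. The variable `T`
records the lags, so that periodic points do not destroy faithfulness. -/
noncomputable def pointRep (hX : IsSubshift X) :
    SubshiftAlgebra R X →ₐ[R] Module.End R[T;T⁻¹] (X →₀ R[T;T⁻¹]) :=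
  RingQuot.liftAlgHom R ⟨freePointRep R X, freePointRep_rel R hX⟩

open Classical in
theorem pointRep_projection (hX : IsSubshift X) (A : boolAlg X) :
    pointRep R hX (projection R X A) = translation R (PEquiv.ofSet (A : Set X)) 0 :=
  (RingQuot.liftAlgHom_mkAlgHom_apply ..).trans (freePointRep_freeP R A)

theorem pointRep_sWord (hX : IsSubshift X) (α : List 𝒜) :
    pointRep R hX (sWord R X α) = translation R (prepend X α) α.length := by
  rw [← mkAlgHom_freeSWord]
  exact (RingQuot.liftAlgHom_mkAlgHom_apply ..).trans (freePointRep_freeSWord R hX α)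

theorem pointRep_star_sWord (hX : IsSubshift X) (α : List 𝒜) :
    pointRep R hX (star (sWord R X α)) = translation R (prepend X α).symm (-α.length) := by
  rw [← mkAlgHom_freeSStarWord]
  exact (RingQuot.liftAlgHom_mkAlgHom_apply ..).trans (freePointRep_freeSStarWord R hX α)

variable {R} {hX : IsSubshift X} {A : boolAlg X} {x y q : X} {α β : List 𝒜} {z : ℕ → 𝒜}
  {c : R[T;T⁻¹]}

open Classical in
theorem pointRep_projection_apply (f : X →₀ R[T;T⁻¹]) :
    pointRep R hX (projection R X A) f = f.filter (· ∈ (A : Set X)) := by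
  rw [pointRep_projection, translation_ofSet_apply]

theorem pointRep_projection_single (hx : x ∈ (A : Set X)) :
    pointRep R hX (projection R X A) (.single x c) = .single x c := by
  classical
  rw [pointRep_projection_apply]
  exact Finsupp.filter_single_of_pos _ hx

theorem pointRep_projection_single_eq_zero (hx : x ∉ (A : Set X)) :
    pointRep R hX (projection R X A) (.single x c) = 0 := by
  classical
  rw [pointRep_projection_apply]
  exact Finsupp.filter_single_of_neg _ hx

theorem pointRep_monomial_single (hA : x ∈ (A : Set X)) (hx : (x : ℕ → 𝒜) = concat β z)
    (hy : (y : ℕ → 𝒜) = concat α z) :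
    pointRep R hX (sWord R X α * star (sWord R X β) * projection R X A) (.single x c) =
      .single y (c * T (α.length - β.length)) := by
  have hz : z ∈ X := hX.mem_of_concat_mem (hx ▸ x.2)
  have hβ : (⟨z, hz⟩ : X) ∈ (prepend X β).symm x :=
    (PEquiv.mem_iff_mem _).mpr (mem_prepend.mpr hx)
  rw [map_mul, Module.End.mul_apply, pointRep_projection_single hA, map_mul,
    Module.End.mul_apply, pointRep_star_sWord, translation_single hβ, pointRep_sWord,
    translation_single (mem_prepend.mpr hy), mul_assoc, ← T_add, neg_add_eq_sub]

theorem pointRep_monomial_single_eq_zero (hA : x ∉ (A : Set X)) :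
    pointRep R hX (sWord R X α * star (sWord R X β) * projection R X A) (.single x c) = 0 := by
  rw [map_mul, Module.End.mul_apply, pointRep_projection_single_eq_zero hA, map_zero]

theorem exists_pointRep_single_eq {n : ℤ} (hn : n ∈ lags (x : ℕ → 𝒜) y) :
    ∃ w, pointRep R hX w (.single x c) = .single y (c * T n) := by
  obtain ⟨α, β, z, hx, hy, rfl⟩ := hn
  exact ⟨_, pointRep_monomial_single (A := ⊤) trivial hx hy⟩

variable (hX) in
theorem pointRep_single_apply_mem_span (hl : ∀ a : 𝒜, [a] ∈ language X)
    (w : SubshiftAlgebra R X) (x y : X) :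
    pointRep R hX w (.single x 1) y ∈ Submodule.span R (T '' lags (x : ℕ → 𝒜) y) := by
  classical
  induction w using monomials_induction hX hl with
  | mem α β D hD =>
    by_cases hx : x ∈ (D : Set X)
    · obtain ⟨z, hxz, hz⟩ := hD hx
      rw [pointRep_monomial_single (y := ⟨_, hz⟩) hx hxz rfl, one_mul, Finsupp.single_apply]
      split_ifs with hy
      · exact Submodule.subset_span ⟨_, ⟨α, β, z, hxz, congrArg Subtype.val hy.symm, rfl⟩, rfl⟩
      · exact zero_mem _
    · rw [pointRep_monomial_single_eq_zero hx]
      exact zero_mem _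
  | zero => rw [map_zero]; exact zero_mem _
  | add w w' hw hw' =>
    rw [map_add, LinearMap.add_apply, Finsupp.add_apply]
    exact add_mem hw hw'
  | smul r w hw =>
    rw [map_smul, LinearMap.smul_apply, Finsupp.smul_apply]
    exact Submodule.smul_mem _ r hw

variable (hX) in
theorem exists_projection_apply_eq_single (f : X →₀ R[T;T⁻¹]) (q : X) :
    ∃ Z : boolAlg X, q ∈ (Z : Set X) ∧
      pointRep R hX (projection R X Z) f = .single q (f q) := by
  classical
  obtain ⟨Z, hq, hZ⟩ := exists_mem_forall_notMem hX (Finset.notMem_erase q f.support)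
  refine ⟨Z, hq, Finsupp.ext fun x => ?_⟩
  rw [pointRep_projection_apply, Finsupp.single_apply]
  split_ifs with hx
  · rw [← hx, Finsupp.filter_apply_pos _ _ hq]
  · by_cases hxZ : x ∈ (Z : Set X)
    · rw [Finsupp.filter_apply_pos _ _ hxZ]
      by_contra hfx
      exact hZ x (Finset.mem_erase.mpr ⟨Ne.symm hx, Finsupp.mem_support_iff.mpr hfx⟩) hxZ
    · exact Finsupp.filter_apply_neg _ _ hxZ

end Representation

section Germ

open LaurentPolynomial

variable (R : Type*) [CommRing R] {X : Set (ℕ → 𝒜)}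

theorem sWord_mul_star_sWord_mul_star_sWord (hX : IsSubshift X) (hl : ∀ a : 𝒜, [a] ∈ language X)
    (β γ : List 𝒜) :
    sWord R X γ * star (sWord R X γ) * star (sWord R X β) =
      star (sWord R X β) * projection R X (cyl X [] (β ++ γ)) :=
  calc sWord R X γ * star (sWord R X γ) * star (sWord R X β)
      = (sWord R X γ * star (sWord R X γ)) * (star (sWord R X β) * sWord R X β) *
          star (sWord R X β) := by
        rw [mul_assoc _ (star (sWord R X β) * _), star_mul_mul_star (sWord_mul_star_mul R hX hl β)]
    _ = star (sWord R X β) * (sWord R X (β ++ γ) * star (sWord R X (β ++ γ))) := by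
        rw [sWord_mul_star_sWord R hX hl, star_sWord_mul_sWord R hX hl, projection_mul_comm,
          ← sWord_mul_star_sWord R hX hl, ← star_sWord_mul_sWord R hX hl, sWord_append, star_mul]
        simp only [mul_assoc]
    _ = _ := by rw [sWord_mul_star_sWord R hX hl]

variable {α β α' β' : List 𝒜} {U : boolAlg X} {q x : X} {z z' : ℕ → 𝒜} {n : ℤ}

theorem monomial_eq_of_length_le (hX : IsSubshift X) (hl : ∀ a : 𝒜, [a] ∈ language X)
    (hU : U ≤ cyl X α β) (hβ : concat β z = concat β' z') (hα : concat α z = concat α' z')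
    (hn : (α.length : ℤ) - β.length = α'.length - β'.length) (hle : β'.length ≤ β.length) :
    sWord R X α * star (sWord R X β) * projection R X U =
      sWord R X α' * star (sWord R X β') * projection R X U := by
  obtain ⟨γ, rfl, rfl⟩ := exists_append_of_concat_eq hβ hle
  obtain ⟨γ', rfl, hγ⟩ := exists_append_of_concat_eq hα (by omega)
  obtain rfl : γ = γ' := by
    have hlen : γ.length = γ'.length := by
      simp only [List.length_append, Nat.cast_add] at hn
      omega
    rw [← word_concat γ z, hγ, hlen, word_concat]
  have hU' : U ≤ cyl X [] (β' ++ γ) := fun x hx =>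
    let ⟨y, hy, _⟩ := hU hx
    (mem_cyl_nil_left hX).mpr ⟨y, hy⟩
  calc sWord R X (α' ++ γ) * star (sWord R X (β' ++ γ)) * projection R X U
      = sWord R X α' * (sWord R X γ * star (sWord R X γ) * star (sWord R X β')) *
          projection R X U := by
        rw [sWord_append, sWord_append, star_mul]
        simp only [mul_assoc]
    _ = sWord R X α' * star (sWord R X β') *
          (projection R X (cyl X [] (β' ++ γ)) * projection R X U) := by
        rw [sWord_mul_star_sWord_mul_star_sWord R hX hl]
        simp only [mul_assoc]
    _ = _ := by rw [projection_mul_of_ge R hU']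

/-- `m` is a monomial on `U` which maps `q` to `x` with lag `n`. By `IsGerm.unique` it is determined
by `U`, `q`, `x` and `n`. -/
def IsGerm (U : boolAlg X) (q x : X) (n : ℤ) (m : SubshiftAlgebra R X) : Prop :=
  ∃ α β z, U ≤ cyl X α β ∧ (q : ℕ → 𝒜) = concat β z ∧ (x : ℕ → 𝒜) = concat α z ∧
    (α.length : ℤ) - β.length = n ∧ m = sWord R X α * star (sWord R X β) * projection R X U

variable {R}

theorem IsGerm.unique (hX : IsSubshift X) (hl : ∀ a : 𝒜, [a] ∈ language X)
    {m m' : SubshiftAlgebra R X} (hm : IsGerm R U q x n m) (hm' : IsGerm R U q x n m') :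
    m = m' := by
  obtain ⟨α, β, z, hU, hq, hx, rfl, rfl⟩ := hm
  obtain ⟨α', β', z', hU', hq', hx', hn, rfl⟩ := hm'
  have hβ := hq.symm.trans hq'
  have hα := hx.symm.trans hx'
  rcases le_total β'.length β.length with h | h
  · exact monomial_eq_of_length_le R hX hl hU hβ hα hn.symm h
  · exact (monomial_eq_of_length_le R hX hl hU' hβ.symm hα.symm hn h).symm

open Classical in
variable (R) in
/-- The linear map sending `Tⁿ` at the point `x` to the monomial on `U` which maps `q` to `x` with
lag `n`, if there is one. It recovers `w * p_U` from `pointRep w δ_q` when `U` is a small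
neighbourhood of `q`. -/
noncomputable def germMap (U : boolAlg X) (q : X) :
    (X →₀ R[T;T⁻¹]) →ₗ[R] SubshiftAlgebra R X :=
  Finsupp.lsum R fun x =>
    (Finsupp.linearCombination R fun n =>
      if h : ∃ m, IsGerm R U q x n m then h.choose else 0) ∘ₗ
        (AddMonoidAlgebra.coeffLinearEquiv R).toLinearMap

theorem germMap_single (hX : IsSubshift X) (hl : ∀ a : 𝒜, [a] ∈ language X)
    {m : SubshiftAlgebra R X} (hm : IsGerm R U q x n m) :
    germMap R U q (.single x (T n)) = m := by
  have hT : AddMonoidAlgebra.coeffLinearEquiv R (T n : R[T;T⁻¹]) = Finsupp.single n 1 := rfl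
  have hex : ∃ m, IsGerm R U q x n m := ⟨m, hm⟩
  rw [germMap, Finsupp.lsum_single, LinearMap.comp_apply, LinearEquiv.coe_coe, hT,
    Finsupp.linearCombination_single, one_smul, dif_pos hex]
  exact hex.choose_spec.unique hX hl hm

theorem germMap_pointRep_monomial (hX : IsSubshift X) (hl : ∀ a : 𝒜, [a] ∈ language X)
    {D : boolAlg X} (hD : D ≤ cyl X α β) (hU : U ≤ D) (hq : q ∈ (U : Set X)) :
    germMap R U q (pointRep R hX (sWord R X α * star (sWord R X β) * projection R X D)
      (.single q 1)) = sWord R X α * star (sWord R X β) * projection R X D * projection R X U := by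
  obtain ⟨z, hqz, hz⟩ := hD (hU hq)
  rw [pointRep_monomial_single (y := ⟨_, hz⟩) (hU hq) hqz rfl, one_mul, mul_assoc,
    projection_mul_of_ge R hU]
  exact germMap_single hX hl ⟨α, β, z, hU.trans hD, hqz, rfl, rfl, rfl⟩

/-- `U` is so small that `w * p_U` can be read off from `w` at any single point of `U`. -/
def IsGermDomain (hX : IsSubshift X) (w : SubshiftAlgebra R X) (U : boolAlg X) : Prop :=
  ∀ V ≤ U, ∀ q ∈ (V : Set X),
    germMap R V q (pointRep R hX w (.single q 1)) = w * projection R X V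

theorem exists_finset_isGermDomain (hX : IsSubshift X) (hl : ∀ a : 𝒜, [a] ∈ language X)
    (w : SubshiftAlgebra R X) :
    ∃ P : Finset (boolAlg X), P.sup id = ⊤ ∧ ∀ U ∈ P, IsGermDomain hX w U := by
  induction w using monomials_induction hX hl with
  | mem α β D hD =>
    refine ⟨{D, Dᶜ}, by simp, ?_⟩
    simp only [Finset.mem_insert, Finset.mem_singleton, forall_eq_or_imp, forall_eq]
    refine ⟨fun V hV q hq => germMap_pointRep_monomial hX hl hD hV hq, fun V hV q hq => ?_⟩
    rw [pointRep_monomial_single_eq_zero (hV hq), map_zero, mul_assoc,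
      projection_mul_of_disjoint R (disjoint_compl_right.mono_right hV), mul_zero]
  | zero =>
    refine ⟨{⊤}, by simp, fun U _ V _ q _ => ?_⟩
    rw [map_zero, LinearMap.zero_apply, map_zero, zero_mul]
  | add y z hy hz =>
    obtain ⟨P, hP, hPy⟩ := hy
    obtain ⟨Q, hQ, hQz⟩ := hz
    refine ⟨(P ×ˢ Q).image fun i => i.1 ⊓ i.2, ?_, fun U hU => ?_⟩
    · have hsup := Finset.sup_inf_sup P Q id id
      rw [hP, hQ, top_inf_eq] at hsup
      rw [Finset.sup_image, hsup]
      rfl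
    · obtain ⟨i, hi, rfl⟩ := Finset.mem_image.mp hU
      obtain ⟨hiP, hiQ⟩ := Finset.mem_product.mp hi
      intro V hV q hq
      rw [map_add, LinearMap.add_apply, map_add, hPy _ hiP V (hV.trans inf_le_left) q hq,
        hQz _ hiQ V (hV.trans inf_le_right) q hq, add_mul]
  | smul r y hy =>
    obtain ⟨P, hP, hPy⟩ := hy
    refine ⟨P, hP, fun U hU V hV q hq => ?_⟩
    rw [map_smul, LinearMap.smul_apply, map_smul, hPy U hU V hV q hq, smul_mul_assoc]

theorem exists_mem_isGermDomain (hX : IsSubshift X) (hl : ∀ a : 𝒜, [a] ∈ language X)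
    (w : SubshiftAlgebra R X) (q : X) :
    ∃ U : boolAlg X, q ∈ (U : Set X) ∧ IsGermDomain hX w U := by
  obtain ⟨P, hP, hPw⟩ := exists_finset_isGermDomain hX hl w
  by_contra! hcon
  have hq : q ∉ ((P.sup id : boolAlg X) : Set X) :=
    Finset.sup_induction (p := fun V : boolAlg X => q ∉ (V : Set X)) (Set.notMem_empty q)
      (fun _ hV _ hW h => h.elim hV hW) fun U hU hqU => hcon U hqU (hPw U hU)
  rw [hP] at hq
  exact hq trivial

theorem eq_zero_of_forall_pointRep (hX : IsSubshift X) (hl : ∀ a : 𝒜, [a] ∈ language X)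
    {w : SubshiftAlgebra R X} (h : ∀ q : X, pointRep R hX w (.single q 1) = 0) : w = 0 := by
  obtain ⟨P, hP, hPw⟩ := exists_finset_isGermDomain hX hl w
  have hPzero : ∀ U ∈ P, w * projection R X U = 0 := fun U hU => by
    obtain hU' | ⟨q, hq⟩ := (U : Set X).eq_empty_or_nonempty
    · rw [show U = ⊥ from Subtype.ext hU', projection_bot, mul_zero]
    · rw [← hPw U hU U le_rfl q hq, h, map_zero]
  have hsup : w * projection R X (P.sup id) = 0 :=
    Finset.sup_induction (p := fun V => w * projection R X V = 0)
      (by rw [projection_bot, mul_zero])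
      (fun V hV W hW => by
        rw [projection_sup, projection_inf, mul_sub, mul_add, ← mul_assoc, hV, hW, zero_mul,
          add_zero, sub_zero])
      hPzero
  rwa [hP, projection_top, mul_one] at hsup

end Germ

section IrrationalIdeal

open LaurentPolynomial

variable (R : Type*) [CommRing R] {X : Set (ℕ → 𝒜)}

variable (X) in
/-- The sum of the left ideals generated by the projections of the irrational paths. -/
noncomputable def irrationalIdeal : Ideal (SubshiftAlgebra R X) :=
  ⨆ A ∈ irrationalPaths X, Ideal.span {projection R X A}

theorem projection_mem_irrationalIdeal {A : boolAlg X} (hA : A ∈ irrationalPaths X) :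
    projection R X A ∈ irrationalIdeal R X :=
  Ideal.mem_iSup_of_mem A (Ideal.mem_iSup_of_mem hA (Ideal.mem_span_singleton_self _))

variable {R} {A B : boolAlg X} {p q : X}

theorem pointRep_projection_of_eq_singleton (hX : IsSubshift X) (hA : (A : Set X) = {p})
    (f : X →₀ R[T;T⁻¹]) : pointRep R hX (projection R X A) f = .single p (f p) := by
  classical
  rw [pointRep_projection_apply]
  ext1 x
  simp [Finsupp.single_apply, hA, eq_comm]

theorem lags_nonempty_of_pointRep_apply_ne_zero (hX : IsSubshift X)
    (hl : ∀ a : 𝒜, [a] ∈ language X) {w : SubshiftAlgebra R X}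
    (h : pointRep R hX w (.single p 1) q ≠ 0) : (lags (p : ℕ → 𝒜) q).Nonempty := by
  by_contra hempty
  have hmem := pointRep_single_apply_mem_span hX hl w p q
  rw [Set.not_nonempty_iff_eq_empty.mp hempty, Set.image_empty, Submodule.span_empty] at hmem
  exact h hmem

theorem pointRep_single_eq_smul (hX : IsSubshift X) (w : SubshiftAlgebra R X) (x : X)
    (c : R[T;T⁻¹]) : pointRep R hX w (.single x c) = c • pointRep R hX w (.single x 1) := by
  rw [← map_smul, Finsupp.smul_single, smul_eq_mul, mul_one]

theorem eq_of_smul_eq_single {S ι : Type*} [CommSemiring S] [Nontrivial S] {f : ι →₀ S} {c d : S}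
    {x y : ι} (hc : c • f = .single x 1) (hd : d • f = .single y 1) : x = y := by
  have h : Finsupp.single x d = Finsupp.single y c := by
    rw [← mul_one d, ← smul_eq_mul, ← Finsupp.smul_single, ← hc, smul_comm, hd,
      Finsupp.smul_single, smul_eq_mul, mul_one]
  rcases Finsupp.single_eq_single_iff .. |>.mp h with h | h
  · exact h.1
  · rw [h.1, zero_smul, eq_comm, Finsupp.single_eq_zero] at hd
    exact absurd hd one_ne_zero

theorem eq_bot_or_mem_irrationalPaths_of_conj [Nontrivial R] (hX : IsSubshift X)
    (hl : ∀ a : 𝒜, [a] ∈ language X) {u : SubshiftAlgebra R X} (hA : A ∈ irrationalPaths X)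
    (hB : star u * projection R X A * u = projection R X B) :
    B = ⊥ ∨ B ∈ irrationalPaths X := by
  obtain ⟨p, hAp, hp⟩ := (mem_irrationalPaths_iff hX).mp hA
  obtain hempty | ⟨x, hx⟩ := (B : Set X).eq_empty_or_nonempty
  · exact Or.inl (Subtype.ext hempty)
  set f := pointRep R hX (star u) (.single p 1)
  have hf : ∀ y ∈ (B : Set X), ∃ c : R[T;T⁻¹], c • f = .single y 1 := fun y hy =>
    ⟨pointRep R hX u (.single y 1) p, by
      rw [← pointRep_single_eq_smul hX,
        ← pointRep_projection_of_eq_singleton hX hAp (pointRep R hX u (.single y 1)),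
        ← Module.End.mul_apply, ← Module.End.mul_apply, ← map_mul, ← map_mul, hB,
        pointRep_projection_single hy]⟩
  obtain ⟨c, hc⟩ := hf x hx
  have hcx : c * f x = 1 := by simpa using DFunLike.congr_fun hc x
  refine Or.inr ((mem_irrationalPaths_iff hX).mpr ⟨x, ?_, ?_⟩)
  · refine Set.eq_singleton_iff_unique_mem.mpr ⟨hx, fun y hy => ?_⟩
    obtain ⟨d, hd⟩ := hf y hy
    exact eq_of_smul_eq_single hd hc
  · obtain ⟨n, hn⟩ := lags_nonempty_of_pointRep_apply_ne_zero hX hl (p := p) (q := x)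
      (w := star u) (right_ne_zero_of_mul_eq_one hcx)
    exact hp.of_mem_lags hn

theorem mul_mem_irrationalIdeal_of_isNormalizer [Nontrivial R] (hX : IsSubshift X)
    (hl : ∀ a : 𝒜, [a] ∈ language X) {u y : SubshiftAlgebra R X} (hu : IsNormalizer u)
    (hy : y ∈ irrationalIdeal R X) : y * u ∈ irrationalIdeal R X := by
  have hle : irrationalIdeal R X ≤
      Submodule.comap (LinearMap.toSpanSingleton (SubshiftAlgebra R X) _ u)
        (irrationalIdeal R X) := by
    refine iSup₂_le fun A hA => (Ideal.span_singleton_le_iff_mem _).mpr ?_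
    obtain ⟨B, hB, hAB⟩ := hu.exists_projection_mul_eq A
    change projection R X A * u ∈ irrationalIdeal R X
    rw [hAB]
    rcases eq_bot_or_mem_irrationalPaths_of_conj hX hl hA hB with rfl | hB'
    · rw [projection_bot, mul_zero]
      exact zero_mem _
    · exact Ideal.mul_mem_left _ _ (projection_mem_irrationalIdeal R hB')
  exact hle hy

theorem mul_mem_irrationalIdeal [Nontrivial R] (hX : IsSubshift X)
    (hl : ∀ a : 𝒜, [a] ∈ language X) {y : SubshiftAlgebra R X} (hy : y ∈ irrationalIdeal R X)
    (w : SubshiftAlgebra R X) : y * w ∈ irrationalIdeal R X := by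
  induction w using subshiftAlgebra_induction generalizing y with
  | scalar r =>
    rw [← Algebra.commutes]
    exact Ideal.mul_mem_left _ _ hy
  | proj A => exact mul_mem_irrationalIdeal_of_isNormalizer hX hl (isNormalizer_projection A) hy
  | letter a =>
    exact mul_mem_irrationalIdeal_of_isNormalizer hX hl (isNormalizer_sLetter hX hl a) hy
  | star_letter a =>
    exact mul_mem_irrationalIdeal_of_isNormalizer hX hl
      (isNormalizer_star (isNormalizer_sLetter hX hl a)) hy
  | mul v w hv hw =>
    rw [← mul_assoc]
    exact hw (hv hy)
  | add v w hv hw =>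
    rw [mul_add]
    exact add_mem (hv hy) (hw hy)

end IrrationalIdeal

section MinimalLeftIdeal

theorem span_singleton_eq_of_isAtom {B : Type*} [Semiring B] {I : Ideal B} (hI : IsAtom I) {z : B}
    (hz : z ∈ I) (h0 : z ≠ 0) : Ideal.span {z} = I :=
  (hI.le_iff.mp ((Ideal.span_singleton_le_iff_mem I).mpr hz)).resolve_left
    (mt Ideal.span_singleton_eq_bot.mp h0)

theorem isAtom_span_singleton {B : Type*} [Semiring B] {e : B} (he : e ≠ 0)
    (h : ∀ w, w * e ≠ 0 → e ∈ Ideal.span {w * e}) : IsAtom (Ideal.span {e}) := by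
  refine ⟨mt Ideal.span_singleton_eq_bot.mp he, fun I hI => ?_⟩
  by_contra hne
  obtain ⟨z, hz, hz0⟩ := Submodule.exists_mem_ne_zero_of_ne_bot hne
  obtain ⟨w, rfl⟩ := Ideal.mem_span_singleton'.mp (hI.le hz)
  have heI : e ∈ I := (Ideal.span_singleton_le_iff_mem I).mpr hz (h w hz0)
  exact hI.not_ge ((Ideal.span_singleton_le_iff_mem I).mpr heI)

theorem eq_zero_of_isAtom_of_apply_eq_zero {B S M F : Type*} [Semiring B] [Semiring S]
    [AddCommMonoid M] [Module S M] [FunLike F B (Module.End S M)]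
    [MulHomClass F B (Module.End S M)] (φ : F) {I : Ideal B} (hI : IsAtom I) {y z : B} {v : M}
    (hy : y ∈ I) (hyv : φ y v ≠ 0) (hz : z ∈ I) (hzv : φ z v = 0) : z = 0 := by
  by_contra h0
  rw [← span_singleton_eq_of_isAtom hI hz h0] at hy
  obtain ⟨w, rfl⟩ := Ideal.mem_span_singleton'.mp hy
  exact hyv (by rw [map_mul, Module.End.mul_apply, hzv, map_zero])

open LaurentPolynomial

theorem not_isUnit_T_sub_one (R : Type*) [CommRing R] [Nontrivial R] (n : ℤ) :
    ¬ IsUnit (T n - 1 : R[T;T⁻¹]) := fun h => by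
  have heval := h.map (eval₂ (RingHom.id R) (1 : Rˣ))
  rw [map_sub, eval₂_T, map_one, one_zpow, Units.val_one, sub_self] at heval
  exact not_isUnit_zero heval

theorem T_sub_one_ne_zero (R : Type*) [CommRing R] [Nontrivial R] {n : ℤ} (hn : n ≠ 0) :
    (T n - 1 : R[T;T⁻¹]) ≠ 0 := fun h => by
  have hcoeff := congrArg (fun f : R[T;T⁻¹] => f.coeff 0) (sub_eq_zero.mp h)
  rw [← T_zero] at hcoeff
  simp [T_apply, hn] at hcoeff

section CommRing

variable {R : Type*} [CommRing R] {X : Set (ℕ → 𝒜)} {A : boolAlg X} {p q : X}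

theorem mul_projection_eq_zero (hX : IsSubshift X) (hl : ∀ a : 𝒜, [a] ∈ language X)
    (hA : (A : Set X) = {p}) {w : SubshiftAlgebra R X}
    (hw : pointRep R hX w (.single p 1) = 0) : w * projection R X A = 0 := by
  refine eq_zero_of_forall_pointRep hX hl fun r => ?_
  rw [map_mul, Module.End.mul_apply, pointRep_projection_of_eq_singleton hX hA,
    pointRep_single_eq_smul, hw, smul_zero]

theorem exists_pointRep_apply_eq_smul_T (hX : IsSubshift X) (hl : ∀ a : 𝒜, [a] ∈ language X)
    (hp : Aperiodic (p : ℕ → 𝒜)) {w : SubshiftAlgebra R X}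
    (h : pointRep R hX w (.single p 1) q ≠ 0) :
    ∃ n ∈ lags (p : ℕ → 𝒜) q, ∃ c : R, pointRep R hX w (.single p 1) q = c • T n := by
  obtain ⟨n, hn⟩ := lags_nonempty_of_pointRep_apply_ne_zero hX hl h
  have hmem := pointRep_single_apply_mem_span hX hl w p q
  rw [(hp.lags_subsingleton q).eq_singleton_of_mem hn, Set.image_singleton] at hmem
  obtain ⟨c, hc⟩ := Submodule.mem_span_singleton.mp hmem
  exact ⟨n, hn, c, hc.symm⟩

theorem exists_mul_mul_projection_eq_smul (hX : IsSubshift X) (hl : ∀ a : 𝒜, [a] ∈ language X)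
    (hA : A ∈ irrationalPaths X) {w : SubshiftAlgebra R X} (hw : w * projection R X A ≠ 0) :
    ∃ v, ∃ c : R, c ≠ 0 ∧ v * (w * projection R X A) = c • projection R X A := by
  obtain ⟨p, hAp, hp⟩ := (mem_irrationalPaths_iff hX).mp hA
  obtain ⟨q, hq⟩ := Finsupp.ne_iff.mp (mt (mul_projection_eq_zero hX hl hAp) hw)
  obtain ⟨n, hn, c, hc⟩ := exists_pointRep_apply_eq_smul_T hX hl hp hq
  obtain ⟨Z, -, hZ⟩ := exists_projection_apply_eq_single hX (pointRep R hX w (.single p 1)) q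
  obtain ⟨v, hv⟩ := exists_pointRep_single_eq (hX := hX) (c := c • (T n : R[T;T⁻¹]))
    (neg_mem_lags hn)
  refine ⟨v * projection R X Z, c, ?_, ?_⟩
  · rintro rfl
    exact hq (by rw [hc, zero_smul, Finsupp.zero_apply])
  · have hzero := mul_projection_eq_zero hX hl hAp
      (w := v * projection R X Z * w - algebraMap R _ c) (by
        rw [map_sub, map_mul, map_mul, LinearMap.sub_apply, Module.End.mul_apply,
          Module.End.mul_apply, hZ, hc, hv, AlgHom.commutes, Module.algebraMap_end_apply,
          Finsupp.smul_single, smul_mul_assoc, ← T_add, add_neg_cancel, T_zero, sub_self])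
    rw [sub_mul, sub_eq_zero, ← Algebra.smul_def] at hzero
    rw [← mul_assoc, hzero]

theorem exists_mem_pointRep_eq_single (hX : IsSubshift X) (hl : ∀ a : 𝒜, [a] ∈ language X)
    {I : Ideal (SubshiftAlgebra R X)} (hI : I ≠ ⊥) :
    ∃ y ∈ I, ∃ p q : X, ∃ f ≠ 0, pointRep R hX y (.single p 1) = .single q f := by
  obtain ⟨w, hw, hw0⟩ := Submodule.exists_mem_ne_zero_of_ne_bot hI
  obtain ⟨p, hp⟩ := not_forall.mp (mt (eq_zero_of_forall_pointRep hX hl) hw0)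
  obtain ⟨q, hq⟩ := Finsupp.ne_iff.mp hp
  obtain ⟨Z, -, hZ⟩ := exists_projection_apply_eq_single hX (pointRep R hX w (.single p 1)) q
  exact ⟨projection R X Z * w, I.mul_mem_left _ hw, p, q, _, hq, by
    rw [map_mul, Module.End.mul_apply, hZ]⟩

theorem singleton_mem_boolAlg (hX : IsSubshift X) (hl : ∀ a : 𝒜, [a] ∈ language X)
    {y : SubshiftAlgebra R X} (hy : y ≠ 0)
    (h : ∀ W : boolAlg X, q ∈ (W : Set X) → projection R X W * y = y) : {q} ∈ boolAlg X := by
  have hstar : ∀ W : boolAlg X, q ∈ (W : Set X) → star y * projection R X W = star y :=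
    fun W hW => by simpa [star_projection] using congrArg star (h W hW)
  obtain ⟨U, hqU, hU⟩ := exists_mem_isGermDomain hX hl (star y) q
  suffices hsingle : (U : Set X) = {q} from hsingle ▸ U.2
  refine Set.eq_singleton_iff_unique_mem.mpr ⟨hqU, fun r hr => by_contra fun hne => hy ?_⟩
  obtain ⟨W, hqW, hrW⟩ := exists_mem_forall_notMem hX (q := q) (F := {r})
    (by simpa using Ne.symm hne)
  have hzero : pointRep R hX (star y) (.single r 1) = 0 := by
    rw [← hstar W hqW, map_mul, Module.End.mul_apply,
      pointRep_projection_single_eq_zero (hrW r (Finset.mem_singleton_self r)), map_zero]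
  rw [← star_eq_zero, ← hstar U hqU, ← hU U le_rfl r hr, hzero, map_zero]

theorem projection_mul_eq_of_isAtom (hX : IsSubshift X) {I : Ideal (SubshiftAlgebra R X)}
    (hI : IsAtom I) {y : SubshiftAlgebra R X} (hy : y ∈ I) {f : R[T;T⁻¹]} (hf : f ≠ 0)
    (hyp : pointRep R hX y (.single p 1) = .single q f) (hq : q ∈ (A : Set X)) :
    projection R X A * y = y := by
  rw [← sub_eq_zero]
  refine eq_zero_of_isAtom_of_apply_eq_zero (pointRep R hX) hI hy (v := .single p 1) ?_
    (sub_mem (I.mul_mem_left _ hy) hy) ?_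
  · rwa [hyp, Finsupp.single_ne_zero]
  · rw [map_sub, map_mul, LinearMap.sub_apply, Module.End.mul_apply, hyp,
      pointRep_projection_single hq, sub_self]

/- At a point `q` with a nonzero lag `n` to itself, some `g` acts as `Tⁿ`. Then `g * y - y` acts as
`Tⁿ - 1`, and minimality would make this element invertible. -/
theorem aperiodic_of_isAtom [IsDomain R] (hX : IsSubshift X) {I : Ideal (SubshiftAlgebra R X)}
    (hI : IsAtom I) {y : SubshiftAlgebra R X} (hy : y ∈ I) {f : R[T;T⁻¹]} (hf : f ≠ 0)
    (hyp : pointRep R hX y (.single p 1) = .single q f) : Aperiodic (q : ℕ → 𝒜) := by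
  intro n hn
  by_contra h0
  obtain ⟨g, hg⟩ := exists_pointRep_single_eq (R := R) (hX := hX) (c := f) hn
  have hgy : pointRep R hX (g * y - y) (.single p 1) = .single q (f * (T n - 1)) := by
    rw [map_sub, map_mul, LinearMap.sub_apply, Module.End.mul_apply, hyp, hg, mul_sub, mul_one,
      Finsupp.single_sub]
  have hgy0 : g * y - y ≠ 0 := fun h => by
    rw [h, map_zero, LinearMap.zero_apply, eq_comm, Finsupp.single_eq_zero] at hgy
    exact mul_ne_zero hf (T_sub_one_ne_zero R h0) hgy
  have hspan := span_singleton_eq_of_isAtom hI (sub_mem (I.mul_mem_left g hy) hy) hgy0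
  obtain ⟨w, hw⟩ := Ideal.mem_span_singleton'.mp (hspan ▸ hy)
  have hfw : f * ((T n - 1) * pointRep R hX w (.single q 1) q) = f * 1 := by
    have happ : pointRep R hX (w * (g * y - y)) (.single p 1) q = f := by
      rw [hw, hyp, Finsupp.single_eq_same]
    rw [map_mul, Module.End.mul_apply, hgy, pointRep_single_eq_smul, Finsupp.smul_apply,
      smul_eq_mul] at happ
    rw [← mul_assoc, happ, mul_one]
  exact not_isUnit_T_sub_one R n (.of_mul_eq_one _ (mul_left_cancel₀ hf hfw))

theorem le_irrationalIdeal_of_isAtom [IsDomain R] (hX : IsSubshift X)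
    (hl : ∀ a : 𝒜, [a] ∈ language X) {I : Ideal (SubshiftAlgebra R X)} (hI : IsAtom I) :
    I ≤ irrationalIdeal R X := by
  obtain ⟨y, hy, p, q, f, hf, hyp⟩ := exists_mem_pointRep_eq_single hX hl hI.1
  have hy0 : y ≠ 0 := by
    rintro rfl
    rw [map_zero, LinearMap.zero_apply, eq_comm, Finsupp.single_eq_zero] at hyp
    exact hf hyp
  have hfix : ∀ W : boolAlg X, q ∈ (W : Set X) → projection R X W * y = y :=
    fun _ => projection_mul_eq_of_isAtom hX hI hy hf hyp
  have hqU := singleton_mem_boolAlg hX hl hy0 hfix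
  have hqIrr : (⟨{q}, hqU⟩ : boolAlg X) ∈ irrationalPaths X :=
    (mem_irrationalPaths_iff hX).mpr ⟨q, rfl, aperiodic_of_isAtom hX hI hy hf hyp⟩
  rw [← span_singleton_eq_of_isAtom hI hy hy0, Ideal.span_singleton_le_iff_mem, ← hfix ⟨_, hqU⟩ rfl]
  exact mul_mem_irrationalIdeal hX hl (projection_mem_irrationalIdeal R hqIrr) y

end CommRing

theorem isAtom_span_projection {R : Type*} [Field R] {X : Set (ℕ → 𝒜)} (hX : IsSubshift X)
    (hl : ∀ a : 𝒜, [a] ∈ language X) {A : boolAlg X} (hA : A ∈ irrationalPaths X) :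
    IsAtom (Ideal.span {projection R X A}) := by
  refine isAtom_span_singleton (fun h => ?_) fun w hw => ?_
  · obtain ⟨p, hAp, -⟩ := (mem_irrationalPaths_iff hX).mp hA
    have hsingle := pointRep_projection_single (R := R) (hX := hX) (A := A) (x := p) (c := 1)
      (hAp ▸ rfl)
    rw [h, map_zero, LinearMap.zero_apply, eq_comm, Finsupp.single_eq_zero] at hsingle
    exact one_ne_zero hsingle
  · obtain ⟨v, c, hc, hv⟩ := exists_mul_mul_projection_eq_smul hX hl hA hw
    refine Ideal.mem_span_singleton'.mpr ⟨c⁻¹ • v, ?_⟩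
    rw [smul_mul_assoc, hv, inv_smul_smul₀ hc]

end MinimalLeftIdeal

end UnitalSubshift

/-- The socle of the unital subshift algebra is the sum of the left ideals generated by the
projections of the irrational paths. Every letter of the alphabet is assumed to occur in `X`. -/
theorem mainTheorem1 {𝒜 : Type*} (R : Type*) [Field R] (X : Set (ℕ → 𝒜))
    (hX : UnitalSubshift.IsSubshift X)
    (hletters : ∀ a : 𝒜, [a] ∈ UnitalSubshift.language X) :
    UnitalSubshift.leftSocle (UnitalSubshift.SubshiftAlgebra R X) =
      ⨆ A ∈ UnitalSubshift.irrationalPaths X,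
        Ideal.span {UnitalSubshift.projection R X A} :=
  le_antisymm
    (sSup_le fun _ hI => UnitalSubshift.le_irrationalIdeal_of_isAtom hX hletters hI)
    (iSup₂_le fun _ hA => le_sSup (UnitalSubshift.isAtom_span_projection hX hletters hA))
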